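/- Let $n\ge 2$ and let $j\ge 1$ be an integer with $j\not\equiv 0 \pmod n$. Let $e_{ik}$ be the elementary $n\times n$ matrices, $e_1=(1,0,\dots,0)^t$, $b=\sum_{i=1}^{n-1}e_{i+1,i}$, $J=e_{1n}\lambda+b$, $V_n=\bigoplus_{i=1}^{n-1}\mathbb{R}e_{in}$, and write $[\partial_x+b+u,C]=C_x+[b+u,C]$. *Curves.* $\mathcal{M}_n(\mathbb{R})$ is the set of smooth curves $\gamma:\mathbb{R}\to\mathbb{R}^n\setminus\{0\}$ with $\det(\gamma,\gamma_x,\dots,\gamma_x^{(n-1)})=1$. The central affine moving frame of such a $\gamma$ is $g=(\gamma,\gamma_x,\dots,\gamma_x^{(n-1)})$, and its central affine curvature is $\Psi(\gamma)=u=\sum_{i=1}^{n-1}u_ie_{in}$, where $u_i$ is the determinant of $g$ with its $i$-th column replaced by $\gamma_x^{(n)}$ (so that $\gamma_x^{(n)}=u_1\gamma+\dots+u_{n-1}\gamma_x^{(n-2)}$). *Flows.* For $u\in C^\infty(\mathbb{R},V_n)$ let $Y(u,\lambda)=e_{1n}\lambda+\sum_{i\le 0}Y_i(u)\lambda^i$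 be the formal series with coefficients in $C^\infty(\mathbb{R},sl(n,\mathbb{R}))$ such that $[\partial_x+J+u,Y(u,\lambda)]=0$ and $Y(u,\lambda)^n=\lambda\,\mathrm{I}_n$. Let $Y_{j,0}(u)$ be the coefficient of $\lambda^0$ in $Y(u,\lambda)^j$, let $\zeta_j(u)$ be the smooth strictly upper triangular matrix-valued function with $[\partial_x+b+u,\,Y_{j,0}(u)-\zeta_j(u)]\in V_n$, and set $Z_{j,0}(u)=Y_{j,0}(u)-\zeta_j(u)$. The $j$-th central affine curve flow on $\mathcal{M}_n(\mathbb{R})$ is $$\gamma_t=g\,Z_{j,0}(u)\,e_1,\qquad (1)$$ where $g(\cdot,t)$ and $u(\cdot,t)$ are the moving frame and the curvature of $\gamma(\cdot,t)\in\mathcal{M}_n(\mathbb{R})$; the $j$-th $A^{(1)}_{n-1}$-KdV flow on $C^\infty(\mathbb{R},V_n)$ is $$u_t=[\partial_x+b+u,\,Z_{j,0}(u)].\qquad (2)$$ Solutions of (1) and (2) are understood to be smooth in $(x,t)\in\mathbb{R}^2$. The group $SL(n,\mathbb{R})$ acts on the solutions of (1) by $(c\cdot\gamma)(x,t)=c\,\gamma(x,t)$.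 Then: 1. If $\gamma_1,\gamma_2$ are solutions of (1), then $\Psi(\gamma_1(\cdot,t))=\Psi(\gamma_2(\cdot,t))$ for all $t\in\mathbb{R}$ if and only if there is a constant $c_0\in SL(n,\mathbb{R})$ such that $\gamma_2=c_0\gamma_1$. 2. The map $\gamma\mapsto u$, $u(\cdot,t)=\Psi(\gamma(\cdot,t))$, induces a bijection from the space of solutions of (1) modulo $SL(n,\mathbb{R})$ onto the space of solutions of (2). -/

import Mathlib

open scoped ContDiff

namespace CentralAffine

open Matrix

/-! ### Curves, frames and central affine curvature -/

/-- The frame `(γ, γ_x, …, γ_x^{(n-1)})`: its `k`-th column (counted from `0`) is `γ_x^{(k)}`. -/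
noncomputable def frame (n : ℕ) (γ : ℝ → Fin n → ℝ) (x : ℝ) : Matrix (Fin n) (Fin n) ℝ :=
  Matrix.of fun i k => iteratedDeriv (k : ℕ) γ x i

/-- Membership in `𝓜ₙ(ℝ)`: smooth curves parametrized by central affine arc-length.
(Such a curve never passes through the origin, its position being a column of the frame.) -/
structure IsArcLengthCurve (n : ℕ) (γ : ℝ → Fin n → ℝ) : Prop where
  smooth : ContDiff ℝ ∞ γ
  det_frame : ∀ x, (frame n γ x).det = 1

/-- The central affine curvature map `Ψ(γ) = ∑_{i=1}^{n-1} u_i e_{in}`, where `u_i` is the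
determinant of the frame with its `i`-th column replaced by `γ_x^{(n)}`. -/
noncomputable def curvature (n : ℕ) (γ : ℝ → Fin n → ℝ) (x : ℝ) : Matrix (Fin n) (Fin n) ℝ :=
  Matrix.of fun i k =>
    if (k : ℕ) + 1 = n ∧ (i : ℕ) + 1 < n then
      ((frame n γ x).updateCol i (iteratedDeriv n γ x)).det
    else 0

/-! ### Matrices and operators -/

/-- `b = ∑_{i=1}^{n-1} e_{i+1,i}`. -/
def bMat (n : ℕ) : Matrix (Fin n) (Fin n) ℝ :=
  Matrix.of fun i k => if (i : ℕ) = (k : ℕ) + 1 then 1 else 0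

/-- `e_{1n}`. -/
def cornerMat (n : ℕ) : Matrix (Fin n) (Fin n) ℝ :=
  Matrix.of fun i k => if (i : ℕ) = 0 ∧ (k : ℕ) + 1 = n then 1 else 0

/-- The first basis vector `e_1 = (1, 0, …, 0)ᵗ`. -/
def firstVec (n : ℕ) : Fin n → ℝ := fun i => if (i : ℕ) = 0 then 1 else 0

/-- `A ∈ Vₙ = ⊕_{i=1}^{n-1} ℝ e_{in}`. -/
def InV (n : ℕ) (A : Matrix (Fin n) (Fin n) ℝ) : Prop :=
  ∀ i k : Fin n, ¬ ((k : ℕ) + 1 = n ∧ (i : ℕ) + 1 < n) → A i k = 0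

/-- The entrywise derivative `A_x` of a matrix-valued function. -/
noncomputable def matDeriv (n : ℕ) (A : ℝ → Matrix (Fin n) (Fin n) ℝ) (x : ℝ) :
    Matrix (Fin n) (Fin n) ℝ :=
  Matrix.of fun i k => deriv (fun y => A y i k) x

/-- Smoothness of a matrix-valued function of one variable. -/
def MatSmooth (n : ℕ) (A : ℝ → Matrix (Fin n) (Fin n) ℝ) : Prop :=
  ∀ i k : Fin n, ContDiff ℝ ∞ fun x => A x i k

/-- `[∂_x + b + u, C] = C_x + (b + u) C - C (b + u)`. -/
noncomputable def bracket (n : ℕ) (u C : ℝ → Matrix (Fin n) (Fin n) ℝ) (x : ℝ) :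
    Matrix (Fin n) (Fin n) ℝ :=
  matDeriv n C x + ((bMat n + u x) * C x - C x * (bMat n + u x))

/-! ### The series `Y(u, λ)` and the matrices `Z_{j,0}(u)` -/

/-- Formal series `∑_{k ≤ k₀} A_k λ^k` with real `n × n` matrix coefficients, as Laurent series
in the variable `λ⁻¹`. -/
abbrev Loop (n : ℕ) : Type := LaurentSeries (Matrix (Fin n) (Fin n) ℝ)

/-- The coefficient of `λ^k`. -/
def lamCoeff {n : ℕ} (A : Loop n) (k : ℤ) : Matrix (Fin n) (Fin n) ℝ := A.coeff (-k)

/-- The monomial `A λ^k`. -/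
noncomputable def monomial {n : ℕ} (A : Matrix (Fin n) (Fin n) ℝ) (k : ℤ) : Loop n :=
  HahnSeries.single (-k) A

/-- `J = e_{1n} λ + b`. -/
noncomputable def JMat (n : ℕ) : Loop n := monomial (cornerMat n) 1 + monomial (bMat n) 0

/-- `Y = Y(u, λ)`: the `sl(n)`-valued series, smooth in `x`, with leading term `e_{1n} λ`,
that satisfies `[∂_x + J + u, Y] = 0` and `Yⁿ = λ I`. The leading term singles out one of
the solutions of these two equations, which are otherwise determined only up to an `n`-th
root of unity. -/
structure IsY (n : ℕ) (u : ℝ → Matrix (Fin n) (Fin n) ℝ) (Y : ℝ → Loop n) : Prop where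
  smooth : ∀ k : ℤ, MatSmooth n fun x => lamCoeff (Y x) k
  trace_zero : ∀ (k : ℤ) (x : ℝ), (lamCoeff (Y x) k).trace = 0
  leading : ∀ x, lamCoeff (Y x) 1 = cornerMat n
  bounded : ∀ k : ℤ, 1 < k → ∀ x, lamCoeff (Y x) k = 0
  commutes : ∀ (k : ℤ) (x : ℝ),
    matDeriv n (fun y => lamCoeff (Y y) k) x +
      lamCoeff ((JMat n + monomial (u x) 0) * Y x - Y x * (JMat n + monomial (u x) 0)) k = 0
  pow_eq : ∀ x, Y x ^ n = monomial 1 1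

open Classical in
/-- The series `Y(u, λ)` (with the value `0` should there be none). -/
noncomputable def seriesY (n : ℕ) (u : ℝ → Matrix (Fin n) (Fin n) ℝ) : ℝ → Loop n :=
  if h : ∃ Y, IsY n u Y then h.choose else 0

/-- `Y_{j,0}(u)`, the coefficient of `λ^0` in `Y(u, λ)^j`. -/
noncomputable def Yj0 (n j : ℕ) (u : ℝ → Matrix (Fin n) (Fin n) ℝ) (x : ℝ) :
    Matrix (Fin n) (Fin n) ℝ :=
  lamCoeff (seriesY n u x ^ j) 0

/-- `ζ = ζ_j(u)`: smooth, strictly upper triangular, with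
`[∂_x + b + u, Y_{j,0}(u) - ζ] ∈ Vₙ`. -/
structure IsZeta (n j : ℕ) (u ζ : ℝ → Matrix (Fin n) (Fin n) ℝ) : Prop where
  smooth : MatSmooth n ζ
  strictUpper : ∀ (x : ℝ) (i k : Fin n), k ≤ i → ζ x i k = 0
  bracket_mem : ∀ x, InV n (bracket n u (fun y => Yj0 n j u y - ζ y) x)

open Classical in
/-- The correction `ζ_j(u)` (with the value `0` should there be none). -/
noncomputable def zeta (n j : ℕ) (u : ℝ → Matrix (Fin n) (Fin n) ℝ) :
    ℝ → Matrix (Fin n) (Fin n) ℝ :=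
  if h : ∃ ζ, IsZeta n j u ζ then h.choose else 0

/-- `Z_{j,0}(u) = Y_{j,0}(u) - ζ_j(u)`. -/
noncomputable def Zj0 (n j : ℕ) (u : ℝ → Matrix (Fin n) (Fin n) ℝ) (x : ℝ) :
    Matrix (Fin n) (Fin n) ℝ :=
  Yj0 n j u x - zeta n j u x

/-! ### The two flows -/

/-- `γ(x, t)` is a smooth solution on `ℝ²` of the `j`-th central affine curve flow
`γ_t = g Z_{j,0}(u) e_1` on `𝓜ₙ(ℝ)`, where `g(·, t)` and `u(·, t)` are the frame and the
curvature of `γ(·, t)`. -/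
structure IsCurveFlowSolution (n j : ℕ) (γ : ℝ → ℝ → Fin n → ℝ) : Prop where
  smooth : ContDiff ℝ ∞ fun p : ℝ × ℝ => γ p.1 p.2
  mem : ∀ t, IsArcLengthCurve n fun x => γ x t
  flow : ∀ x t, deriv (fun s => γ x s) t =
    (frame n (fun y => γ y t) x * Zj0 n j (curvature n fun y => γ y t) x) *ᵥ firstVec n

/-- `u(x, t)` is a smooth solution on `ℝ²` of the `j`-th `A^{(1)}_{n-1}`-KdV flow
`u_t = [∂_x + b + u, Z_{j,0}(u)]` on `C^∞(ℝ, Vₙ)`. -/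
structure IsKdVSolution (n j : ℕ) (u : ℝ → ℝ → Matrix (Fin n) (Fin n) ℝ) : Prop where
  smooth : ∀ i k : Fin n, ContDiff ℝ ∞ fun p : ℝ × ℝ => u p.1 p.2 i k
  mem : ∀ x t, InV n (u x t)
  flow : ∀ x t, matDeriv n (fun s => u x s) t =
    bracket n (fun y => u y t) (Zj0 n j fun y => u y t) x

/-- The space of solutions of the `j`-th central affine curve flow. -/
def CurveFlowSolution (n j : ℕ) : Type :=
  {γ : ℝ → ℝ → Fin n → ℝ // IsCurveFlowSolution n j γ}

/-- The space of solutions of the `j`-th `A^{(1)}_{n-1}`-KdV flow. -/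
def KdVSolution (n j : ℕ) : Type :=
  {u : ℝ → ℝ → Matrix (Fin n) (Fin n) ℝ // IsKdVSolution n j u}

/-! ### The action of `SL(n, ℝ)` on solutions of the curve flow -/

theorem iteratedDeriv_mulVec {n : ℕ} (c : Matrix (Fin n) (Fin n) ℝ) {γ : ℝ → Fin n → ℝ}
    (h : ContDiff ℝ ∞ γ) (k : ℕ) :
    iteratedDeriv k (fun x => c *ᵥ γ x) = fun x => c *ᵥ iteratedDeriv k γ x := by
  induction k with
  | zero => simp
  | succ k ih =>
    funext x
    rw [iteratedDeriv_succ, ih, iteratedDeriv_succ]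
    have hd : DifferentiableAt ℝ (iteratedDeriv k γ) x :=
      (h.differentiable_iteratedDeriv k (by exact_mod_cast WithTop.coe_lt_top k)) x
    exact ((LinearMap.toContinuousLinearMap (Matrix.toLin' c)).hasFDerivAt.comp_hasDerivAt x
      hd.hasDerivAt).deriv

theorem frame_mulVec {n : ℕ} (c : Matrix (Fin n) (Fin n) ℝ) {γ : ℝ → Fin n → ℝ}
    (h : ContDiff ℝ ∞ γ) (x : ℝ) :
    frame n (fun y => c *ᵥ γ y) x = c * frame n γ x := by
  ext i k
  simp [frame, iteratedDeriv_mulVec c h, Matrix.mul_apply, Matrix.mulVec, dotProduct]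

theorem curvature_mulVec {n : ℕ} (c : Matrix.SpecialLinearGroup (Fin n) ℝ)
    {γ : ℝ → Fin n → ℝ} (h : ContDiff ℝ ∞ γ) :
    curvature n (fun y => (c : Matrix (Fin n) (Fin n) ℝ) *ᵥ γ y) = curvature n γ := by
  funext x
  ext i k
  have key : (frame n (fun y => (c : Matrix (Fin n) (Fin n) ℝ) *ᵥ γ y) x).updateCol i
      (iteratedDeriv n (fun y => (c : Matrix (Fin n) (Fin n) ℝ) *ᵥ γ y) x) =
      (c : Matrix (Fin n) (Fin n) ℝ) * (frame n γ x).updateCol i (iteratedDeriv n γ x) := by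
    rw [frame_mulVec _ h, iteratedDeriv_mulVec _ h]
    ext p q
    by_cases hq : q = i
    · subst hq
      simp [Matrix.mul_apply, Matrix.mulVec, dotProduct]
    · simp [Matrix.mul_apply, hq]
  simp [curvature, key]

theorem IsCurveFlowSolution.smul {n j : ℕ} (c : Matrix.SpecialLinearGroup (Fin n) ℝ)
    {γ : ℝ → ℝ → Fin n → ℝ} (h : IsCurveFlowSolution n j γ) :
    IsCurveFlowSolution n j fun x t => (c : Matrix (Fin n) (Fin n) ℝ) *ᵥ γ x t where
  smooth := (LinearMap.toContinuousLinearMap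
    (Matrix.toLin' (c : Matrix (Fin n) (Fin n) ℝ))).contDiff.comp h.smooth
  mem t := by
    refine ⟨(LinearMap.toContinuousLinearMap
      (Matrix.toLin' (c : Matrix (Fin n) (Fin n) ℝ))).contDiff.comp (h.mem t).smooth, fun x => ?_⟩
    rw [frame_mulVec _ (h.mem t).smooth, Matrix.det_mul, (h.mem t).det_frame, c.det_coe, one_mul]
  flow x t := by
    have hd : DifferentiableAt ℝ (fun s => γ x s) t := by
      have : ContDiff ℝ ∞ fun s : ℝ => γ x s :=
        h.smooth.comp (contDiff_const.prodMk contDiff_id)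
      exact (this.differentiable (by simp)) t
    have e := ((LinearMap.toContinuousLinearMap (Matrix.toLin'
      (c : Matrix (Fin n) (Fin n) ℝ))).hasFDerivAt.comp_hasDerivAt t hd.hasDerivAt).deriv
    rw [curvature_mulVec c (h.mem t).smooth, frame_mulVec _ (h.mem t).smooth, Matrix.mul_assoc,
      ← Matrix.mulVec_mulVec, ← h.flow x t]
    exact e

/-- `SL(n, ℝ)` acts on solutions of the curve flow by `(c · γ)(x, t) = c γ(x, t)`. -/
noncomputable instance (n j : ℕ) :
    MulAction (Matrix.SpecialLinearGroup (Fin n) ℝ) (CurveFlowSolution n j) where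
  smul c γ := ⟨fun x t => (c : Matrix (Fin n) (Fin n) ℝ) *ᵥ γ.1 x t, γ.2.smul c⟩
  one_smul γ := by
    apply Subtype.ext
    funext x t
    change ((1 : Matrix.SpecialLinearGroup (Fin n) ℝ) : Matrix (Fin n) (Fin n) ℝ) *ᵥ _ = _
    simp
  mul_smul c d γ := by
    apply Subtype.ext
    funext x t
    change ((c * d : Matrix.SpecialLinearGroup (Fin n) ℝ) : Matrix (Fin n) (Fin n) ℝ) *ᵥ _ =
      (c : Matrix (Fin n) (Fin n) ℝ) *ᵥ ((d : Matrix (Fin n) (Fin n) ℝ) *ᵥ _)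
    simp [Matrix.mulVec_mulVec]

end CentralAffine

/-!
# Central affine curve flows and KdV flows

Write `g` for the moving frame of a curve and `u` for its central affine curvature. The argument is
the classical one for integrable curve flows: the frame of a solution of the curve flow satisfies

  `g_x = g (b + u)` and `g_t = g Z` with `Z = Z_{j,0}(u)`,

and the compatibility condition of this pair, `u_t = Z_x + [b + u, Z]`, is the KdV flow.

* The first equation is the Frenet equation (`IsArcLengthCurve.hasMatDerivAt_frame`). The second
  one is the flow in the first column, and propagates to the other columns because
  `[∂_x + b + u, Z] ∈ Vₙ` says that `∂_x + b + u` maps each column of `Z` to the next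
  (`IsCurveFlowSolution.hasMatDerivAt_frame`). Equality of the mixed derivatives of `g` then gives
  the KdV flow (`IsCurveFlowSolution.isKdVSolution`).
* Two solutions with the same curvature have frames that solve the same linear equations in `x` and
  in `t`, so these differ by their quotient at the origin
  (`IsCurveFlowSolution.exists_eq_mulVec`).
* Conversely, a solution of the KdV flow makes `(b + u, Z)` a flat connection on `ℝ²`. It has a
  global parallel frame `g` with `det g = 1` (`exists_unimodular_frame`), because the equations are
  linear and their coefficients traceless. The first column of `g` is a solution of the curve flow
  with curvature `u` (`IsKdVSolution.exists_isCurveFlowSolution`).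

All this rests on `Zj0_spec`: the matrix `Z_{j,0}(u)` exists, is traceless, and is smooth in
`(x, t)` if `u` is, although it is defined for each `t` separately. To obtain this, the series `Y(u, λ)` is
constructed over an arbitrary differential `ℚ`-algebra `R`, and `R` is then taken to be the ring of
smooth functions of `(x, t)` with the derivation `∂_x`. The substitution `principal` (conjugation
by `diag(1, μ, …, μ^{n-1})` with `λ = μⁿ`) turns `J` into `μ P` with `P` the cyclic shift matrix.
A formal series in `s = μ⁻¹` conjugates `∂ + J + u` to an operator whose coefficients commute with
`P` (`exists_dressing`), the obstruction at each order being removed by averaging over the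
conjugations by powers of `P` (`exists_commutator_eq`); undoing this conjugation, `Y` is the image
of `μ P` (`exists_isLaxRoot`). The lowest coefficient in `s` of a series that commutes with
`∂ + J + u` commutes with `P`, and this makes `Y` unique (`IsLaxRoot.unique`). Finally, the columns
of `Z_{j,0}(u)` are the iterates of `∂_x + b + u` on the first column of `Y_{j,0}(u)`
(`exists_sub_strictUpper`, `eq_of_bracket_mem`).
-/


open scoped ContDiff

namespace CentralAffine

open Matrix

/-! ### Cyclic shift matrices -/

section Circ

variable {n : ℕ} {R : Type*} [CommRing R]

/-- The `a`-th power of the cyclic shift matrix: its `(i, k)` entry is `1` if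
`i - k ≡ a (mod n)`, and `0` otherwise. -/
def circ (n : ℕ) (R : Type*) [CommRing R] (a : ℤ) : Matrix (Fin n) (Fin n) R :=
  Matrix.of fun i k => if (n : ℤ) ∣ (i : ℤ) - k - a then 1 else 0

/-- The matrix `X` is supported on the cyclic diagonal `i - k ≡ c (mod n)`. -/
def InClass (c : ℤ) (X : Matrix (Fin n) (Fin n) R) : Prop :=
  ∀ i k : Fin n, ¬ (n : ℤ) ∣ (i : ℤ) - k - c → X i k = 0

theorem fin_eq_of_dvd_sub {i k : Fin n} (h : (n : ℤ) ∣ (i : ℤ) - k) : i = k := by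
  obtain ⟨c, hc⟩ := h
  have hi := i.2
  have hk := k.2
  ext
  have h1 : c < 1 := by
    by_contra hc1
    nlinarith
  have h2 : -1 < c := by
    by_contra hc1
    nlinarith
  have : c = 0 := by omega
  subst this
  omega

theorem exists_fin_dvd_sub (hn : 0 < n) (a : ℤ) : ∃ l : Fin n, (n : ℤ) ∣ a - l := by
  have h0 : (0 : ℤ) < n := by exact_mod_cast hn
  have h1 := Int.emod_nonneg a h0.ne'
  have h2 := Int.emod_lt_of_pos a h0
  refine ⟨⟨(a % n).toNat, by omega⟩, ?_⟩
  simp only [Int.toNat_of_nonneg h1]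
  exact Int.dvd_self_sub_emod

/-- Left multiplication by `circ n R a` shifts the rows of a matrix cyclically. -/
theorem circ_mul_apply {a : ℤ} (X : Matrix (Fin n) (Fin n) R) {i l : Fin n} (k : Fin n)
    (h : (n : ℤ) ∣ (i : ℤ) - l - a) : (circ n R a * X) i k = X l k := by
  rw [Matrix.mul_apply, Finset.sum_eq_single l]
  · simp [circ, h]
  · intro m _ hm
    have : ¬ (n : ℤ) ∣ (i : ℤ) - m - a := fun h' => hm <| by
      refine fin_eq_of_dvd_sub ?_
      obtain ⟨u, hu⟩ := h
      obtain ⟨v, hv⟩ := h'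
      exact ⟨u - v, by linear_combination hu - hv⟩
    simp [circ, this]
  · simp

theorem mul_circ_apply {a : ℤ} (X : Matrix (Fin n) (Fin n) R) (i : Fin n) {l k : Fin n}
    (h : (n : ℤ) ∣ (l : ℤ) - k - a) : (X * circ n R a) i k = X i l := by
  rw [Matrix.mul_apply, Finset.sum_eq_single l]
  · simp [circ, h]
  · intro m _ hm
    have : ¬ (n : ℤ) ∣ (m : ℤ) - k - a := fun h' => hm <| by
      refine fin_eq_of_dvd_sub ?_
      obtain ⟨u, hu⟩ := h
      obtain ⟨v, hv⟩ := h'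
      exact ⟨v - u, by linear_combination hv - hu⟩
    simp [circ, this]
  · simp

theorem circ_mul (hn : 0 < n) (a b : ℤ) : circ n R a * circ n R b = circ n R (a + b) := by
  ext i k
  obtain ⟨l, hl⟩ := exists_fin_dvd_sub hn ((i : ℤ) - a)
  rw [circ_mul_apply _ k (l := l) (by convert hl using 1; ring)]
  have : (n : ℤ) ∣ (l : ℤ) - k - b ↔ (n : ℤ) ∣ (i : ℤ) - k - (a + b) := by
    rw [← dvd_add_right hl]
    ring_nf
  simp [circ, this]

theorem circ_zero : circ n R 0 = 1 := by
  ext i k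
  by_cases h : i = k
  · subst h
    simp [circ]
  · have : ¬ (n : ℤ) ∣ (i : ℤ) - k := fun h' => h (fin_eq_of_dvd_sub h')
    simp [circ, h, this]

theorem circ_self : circ n R n = 1 := by
  rw [← circ_zero]
  ext i k
  have : (n : ℤ) ∣ (i : ℤ) - k - n ↔ (n : ℤ) ∣ (i : ℤ) - k - 0 := by
    rw [sub_zero, dvd_sub_self_right]
  simp only [circ, of_apply, this]

theorem circ_mul_neg (hn : 0 < n) (a : ℤ) : circ n R a * circ n R (-a) = 1 := by
  rw [circ_mul hn, add_neg_cancel, circ_zero]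

theorem circ_pow (hn : 0 < n) (a : ℤ) (j : ℕ) : circ n R a ^ j = circ n R (j * a) := by
  induction j with
  | zero => simp [circ_zero]
  | succ j ih => rw [pow_succ, ih, circ_mul hn]; congr 1; push_cast; ring

theorem trace_circ {a : ℤ} (h : ¬ (n : ℤ) ∣ a) : (circ n R a).trace = 0 := by
  refine Finset.sum_eq_zero fun i _ => ?_
  simp [circ, h]

theorem inClass_circ (a : ℤ) : InClass a (circ n R a) := fun i k h => by
  simp [circ, h]

theorem InClass.mul {a b : ℤ} {X Y : Matrix (Fin n) (Fin n) R} (hX : InClass a X)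
    (hY : InClass b Y) : InClass (a + b) (X * Y) := fun i k h => by
  rw [Matrix.mul_apply]
  refine Finset.sum_eq_zero fun l _ => ?_
  by_cases h1 : (n : ℤ) ∣ (i : ℤ) - l - a
  · have h2 : ¬ (n : ℤ) ∣ (l : ℤ) - k - b := fun h2 => h <| by
      obtain ⟨u, hu⟩ := h1
      obtain ⟨v, hv⟩ := h2
      exact ⟨u + v, by linear_combination hu + hv⟩
    rw [hY l k h2, mul_zero]
  · rw [hX i l h1, zero_mul]

theorem InClass.add {a : ℤ} {X Y : Matrix (Fin n) (Fin n) R} (hX : InClass a X)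
    (hY : InClass a Y) : InClass a (X + Y) := fun i k h => by
  simp [hX i k h, hY i k h]

theorem InClass.sub {a : ℤ} {X Y : Matrix (Fin n) (Fin n) R} (hX : InClass a X)
    (hY : InClass a Y) : InClass a (X - Y) := fun i k h => by
  simp [hX i k h, hY i k h]

theorem InClass.sum {a : ℤ} {ι : Type*} {s : Finset ι} {X : ι → Matrix (Fin n) (Fin n) R}
    (hX : ∀ i ∈ s, InClass a (X i)) : InClass a (∑ i ∈ s, X i) := fun i k h => by
  rw [Matrix.sum_apply]
  exact Finset.sum_eq_zero fun l hl => hX l hl i k h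

theorem InClass.map {a : ℤ} {X : Matrix (Fin n) (Fin n) R} (hX : InClass a X) {f : R → R}
    (hf : f 0 = 0) : InClass a (X.map f) := fun i k h => by
  simp [hX i k h, hf]

theorem inClass_zero_one : InClass 0 (1 : Matrix (Fin n) (Fin n) R) := by
  rw [← circ_zero]
  exact inClass_circ 0

/-- A matrix on one cyclic diagonal that commutes with the cyclic shift is a scalar multiple of
a power of the shift. -/
theorem InClass.eq_smul_circ (hn : 0 < n) {c : ℤ} {X : Matrix (Fin n) (Fin n) R}
    (hX : InClass c X) (hc : circ n R 1 * X = X * circ n R 1) :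
    ∃ r : R, X = r • circ n R c := by
  -- `X i k` does not change when both indices move by the same amount
  have hcm : ∀ m : ℕ, circ n R m * X = X * circ n R m := fun m => by
    have := (Commute.pow_left (show Commute (circ n R 1) X from hc) m).eq
    rwa [circ_pow hn, mul_one] at this
  obtain ⟨l₀, h₀⟩ := exists_fin_dvd_sub hn (-c)
  refine ⟨X ⟨0, hn⟩ l₀, ?_⟩
  ext i k
  by_cases h : (n : ℤ) ∣ (i : ℤ) - k - c
  · have h1 : (circ n R i * X) i l₀ = X ⟨0, hn⟩ l₀ := circ_mul_apply X l₀ (by simp)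
    have h2 : (X * circ n R i) i l₀ = X i k := mul_circ_apply X i (by
      obtain ⟨u, hu⟩ := h
      obtain ⟨v, hv⟩ := h₀
      exact ⟨v - u, by linear_combination hv - hu⟩)
    rw [hcm, h2] at h1
    simp [circ, h, h1]
  · simp [circ, h, hX i k h]

/-- Averaging over the conjugations by powers of the cyclic shift `P` solves
`[P, m] = f - r` with `f` in the centralizer of `P`. -/
theorem exists_commutator_eq [Algebra ℚ R] (hn : 0 < n) (r : Matrix (Fin n) (Fin n) R) :
    ∃ m f : Matrix (Fin n) (Fin n) R,
      circ n R 1 * m - m * circ n R 1 = f - r ∧ circ n R 1 * f = f * circ n R 1 ∧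
      ∀ c, InClass c r → InClass (c - 1) m ∧ InClass c f := by
  -- `a i = Pⁱ r P⁻ⁱ` is periodic; `f` is its mean, and `m = -n⁻¹ ∑ i a i P⁻¹` by summation by parts
  set a : ℕ → Matrix (Fin n) (Fin n) R := fun i => circ n R i * r * circ n R (-i) with ha
  have han : a n = a 0 := by
    have : circ n R (-(n : ℤ)) = 1 := by
      have h := circ_mul_neg (R := R) hn (n : ℤ)
      rwa [circ_self, one_mul] at h
    simp [ha, circ_self, circ_zero, this]
  have hn' : (n : ℚ) ≠ 0 := by exact_mod_cast hn.ne'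
  have hsum : ∀ N : ℕ, ∑ i ∈ Finset.range N, (i : ℚ) • (a (i + 1) - a i) =
      (N : ℚ) • a N - ∑ i ∈ Finset.range N, a (i + 1) := by
    intro N
    induction N with
    | zero => simp
    | succ N ih =>
      rw [Finset.sum_range_succ, ih, Finset.sum_range_succ]
      push_cast
      module
  have hshift : ∑ i ∈ Finset.range n, a (i + 1) = ∑ i ∈ Finset.range n, a i := by
    have h1 := Finset.sum_range_succ a n
    rw [Finset.sum_range_succ', han] at h1
    exact add_right_cancel h1
  have hP1 : ∀ i : ℕ, circ n R 1 * a i = a (i + 1) * circ n R 1 := fun i => by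
    simp only [ha, Matrix.mul_assoc]
    rw [circ_mul hn, ← Matrix.mul_assoc, circ_mul hn]
    congr 2
    · push_cast; ring
    · congr 1; push_cast; ring
  refine ⟨-((n : ℚ)⁻¹ • ∑ i ∈ Finset.range n, (i : ℚ) • (a i * circ n R (-1))),
    (n : ℚ)⁻¹ • ∑ i ∈ Finset.range n, a i, ?_, ?_, ?_⟩
  · have h1 : ∀ i : ℕ, circ n R 1 * (a i * circ n R (-1)) = a (i + 1) := fun i => by
      rw [← Matrix.mul_assoc, hP1, Matrix.mul_assoc, circ_mul_neg hn, Matrix.mul_one]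
    have h2 : ∀ i : ℕ, (a i * circ n R (-1)) * circ n R 1 = a i := fun i => by
      rw [Matrix.mul_assoc, circ_mul hn]
      simp [circ_zero]
    have h0 : a 0 = r := by simp [ha, circ_zero]
    simp only [Matrix.mul_neg, Matrix.neg_mul, Matrix.mul_smul, Matrix.smul_mul,
      Matrix.mul_sum, Matrix.sum_mul, h1, h2]
    have h3 := hsum n
    simp only [smul_sub, Finset.sum_sub_distrib] at h3
    rw [hshift, han, h0] at h3
    rw [sub_neg_eq_add, ← sub_eq_neg_add, ← smul_sub, ← neg_sub, h3, smul_neg, smul_sub, smul_smul,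
      inv_mul_cancel₀ hn', one_smul, neg_sub]
  · simp only [Matrix.mul_smul, Matrix.smul_mul, Matrix.mul_sum, Matrix.sum_mul, hP1]
    rw [← Matrix.sum_mul, hshift, Matrix.sum_mul]
  · intro c hc
    have hac : ∀ i, InClass c (a i) := fun i => by
      have := ((inClass_circ (n := n) (R := R) i).mul hc).mul (inClass_circ (-i))
      convert this using 1
      ring
    constructor
    · intro i k h
      have := InClass.sum (s := Finset.range n) (X := fun i : ℕ => (i : ℚ) • (a i * circ n R (-1)))
        (a := c - 1) fun m _ i k h => by
          rw [Matrix.smul_apply, (hac m).mul (inClass_circ (-1)) i k h, smul_zero]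
      rw [Matrix.neg_apply, Matrix.smul_apply, this i k h, smul_zero, neg_zero]
    · intro i k h
      rw [Matrix.smul_apply, InClass.sum (fun m _ => hac m) i k h, smul_zero]

end Circ

/-! ### Dressing the operator `∂ + J + u` -/

section Dressing

variable {n : ℕ} {R : Type*} [CommRing R] (δ : Derivation ℤ R R)

theorem map_derivation_mul (X Y : Matrix (Fin n) (Fin n) R) :
    (X * Y).map δ = X.map δ * Y + X * Y.map δ := by
  ext i k
  simp only [map_apply, Matrix.mul_apply, Matrix.add_apply, map_sum, Derivation.leibniz,
    smul_eq_mul, ← Finset.sum_add_distrib]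
  exact Finset.sum_congr rfl fun l _ => by ring

theorem map_derivation_circ (a : ℤ) : (circ n R a).map δ = 0 := by
  ext i k
  by_cases h : (n : ℤ) ∣ (i : ℤ) - k - a <;> simp [circ, h]

/-- The coefficientwise and entrywise derivative of a power series of matrices. -/
noncomputable def seriesDeriv (f : PowerSeries (Matrix (Fin n) (Fin n) R)) :
    PowerSeries (Matrix (Fin n) (Fin n) R) :=
  PowerSeries.mk fun k => (PowerSeries.coeff k f).map δ

theorem seriesDeriv_mul (f g : PowerSeries (Matrix (Fin n) (Fin n) R)) :
    seriesDeriv δ (f * g) = seriesDeriv δ f * g + f * seriesDeriv δ g := by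
  ext1 k
  have hsum : ∀ (s : Finset (ℕ × ℕ)) (F : ℕ × ℕ → Matrix (Fin n) (Fin n) R),
      (∑ p ∈ s, F p).map δ = ∑ p ∈ s, (F p).map δ := fun s F => by
    ext i k
    simp [Matrix.sum_apply]
  simp only [seriesDeriv, PowerSeries.coeff_mk, PowerSeries.coeff_mul, map_add, hsum,
    map_derivation_mul, Finset.sum_add_distrib]

theorem seriesDeriv_C_circ (a : ℤ) : seriesDeriv δ (PowerSeries.C (circ n R a)) = 0 := by
  ext1 k
  rw [seriesDeriv, PowerSeries.coeff_mk, PowerSeries.coeff_C]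
  split_ifs
  · simp [map_derivation_circ]
  · ext; simp

/-- The coefficient of `s ^ k` of the series `f` lies on the cyclic diagonal `c - k`. -/
def InClassSeries (c : ℤ) (f : PowerSeries (Matrix (Fin n) (Fin n) R)) : Prop :=
  ∀ k : ℕ, InClass (c - k) (PowerSeries.coeff k f)

variable {δ}

theorem InClassSeries.mul {a b : ℤ} {f g : PowerSeries (Matrix (Fin n) (Fin n) R)}
    (hf : InClassSeries a f) (hg : InClassSeries b g) : InClassSeries (a + b) (f * g) := fun k => by
  rw [PowerSeries.coeff_mul]
  refine InClass.sum fun p hp => ?_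
  have h := (hf p.1).mul (hg p.2)
  rw [Finset.HasAntidiagonal.mem_antidiagonal] at hp
  convert h using 1
  rw [← hp]
  push_cast
  ring

theorem inClassSeries_C_circ (a : ℤ) : InClassSeries a (PowerSeries.C (circ n R a)) := fun k => by
  rw [PowerSeries.coeff_C]
  split_ifs with h
  · subst h
    simpa using inClass_circ a
  · exact fun _ _ _ => rfl

/-- If `f * g = 1`, the coefficients of `g` are determined recursively by those of `f`, and lie on
the same cyclic diagonals. -/
theorem InClassSeries.of_mul_eq_one {f g : PowerSeries (Matrix (Fin n) (Fin n) R)}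
    (hf : InClassSeries 0 f) (h0 : PowerSeries.coeff 0 f = 1) (h : f * g = 1) :
    InClassSeries 0 g := fun k => by
  induction k using Nat.strong_induction_on with
  | _ k ih =>
    have h1 := congrArg (PowerSeries.coeff k) h
    rw [PowerSeries.coeff_mul, Finset.sum_eq_add_sum_sdiff_singleton_of_mem
      (show (0, k) ∈ Finset.HasAntidiagonal.antidiagonal k by simp)] at h1
    simp only [h0, one_mul] at h1
    rw [eq_sub_of_add_eq h1]
    refine InClass.sub ?_ (InClass.sum fun p hp => ?_)
    · rw [PowerSeries.coeff_one]
      split_ifs with hk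
      · subst hk
        simpa using inClass_zero_one
      · exact fun _ _ _ => rfl
    · simp only [Finset.mem_sdiff, Finset.HasAntidiagonal.mem_antidiagonal,
        Finset.mem_singleton] at hp
      obtain ⟨hp1, hp2⟩ := hp
      have hlt : p.2 < k := by
        refine lt_of_le_of_ne (by omega) fun h => hp2 ?_
        exact Prod.ext (by omega) h
      have := (hf p.1).mul (ih p.2 hlt)
      convert this using 1
      rw [← hp1]
      push_cast
      ring

/-- A sequence in which each term is a function of the preceding ones exists. -/
theorem exists_seq_of_recursion {A : Type*} [Inhabited A] (Φ : ℕ → (ℕ → A) → A)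
    (hΦ : ∀ k x y, (∀ i < k, x i = y i) → Φ k x = Φ k y) : ∃ r : ℕ → A, ∀ k, r k = Φ k r := by
  let r : ℕ → A := fun k => Nat.strongRec (motive := fun _ => A)
    (fun k ih => Φ k fun i => if h : i < k then ih i h else default) k
  refine ⟨r, fun k => ?_⟩
  have : r k = Φ k fun i => if i < k then r i else default := by
    simp only [r]
    rw [Nat.strongRec_eq]
    congr
  rw [this]
  exact hΦ _ _ _ fun i hi => by simp [hi]

/-- The operator `s ∂ + P + s U`, with `P` the cyclic shift, is conjugate by a formal series
`M = 1 + O(s)` to `s ∂ + P + s F` with `F` in the centralizer of `P`. -/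
theorem exists_dressing [Algebra ℚ R] (hn : 0 < n) (U : PowerSeries (Matrix (Fin n) (Fin n) R))
    (hU : InClassSeries 0 U) :
    ∃ M F : PowerSeries (Matrix (Fin n) (Fin n) R),
      PowerSeries.coeff 0 M = 1 ∧
      PowerSeries.X * seriesDeriv δ M +
          (PowerSeries.C (circ n R 1) + PowerSeries.X * U) * M =
        M * (PowerSeries.C (circ n R 1) + PowerSeries.X * F) ∧
      (∀ k, circ n R 1 * PowerSeries.coeff k F = PowerSeries.coeff k F * circ n R 1) ∧
      InClassSeries 0 M := by
  -- The coefficient of `s ^ (k + 1)` of the equation reads `[P, M (k + 1)] = F k - r k`, where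
  -- `r k` involves only `M 0, …, M k` and `F 0, …, F (k - 1)`. Hence `F k = π (r k)` and
  -- `M (k + 1) = S (r k)`, and the `r k` are found recursively.
  choose S π hSπ hπ hcl using exists_commutator_eq (R := R) hn
  let m : (ℕ → Matrix (Fin n) (Fin n) R) → ℕ → Matrix (Fin n) (Fin n) R :=
    fun r k => Nat.casesOn k 1 fun k => S (r k)
  have : Inhabited (Matrix (Fin n) (Fin n) R) := ⟨0⟩
  obtain ⟨r, hr⟩ := exists_seq_of_recursion
    (fun k r => (m r k).map δ +
        ∑ p ∈ Finset.HasAntidiagonal.antidiagonal k, PowerSeries.coeff p.1 U * m r p.2 -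
      ∑ p ∈ Finset.HasAntidiagonal.antidiagonal k with p.2 < k, m r p.1 * π (r p.2)) (by
    intro k x y hxy
    have hm : ∀ i ≤ k, m x i = m y i := fun i hi => by
      cases i with
      | zero => rfl
      | succ i => simp only [m, hxy i (by omega)]
    congr 1
    · congr 1
      · rw [hm k le_rfl]
      · refine Finset.sum_congr rfl fun p hp => ?_
        rw [Finset.HasAntidiagonal.mem_antidiagonal] at hp
        rw [hm p.2 (by omega)]
    · refine Finset.sum_congr rfl fun p hp => ?_
      rw [Finset.mem_filter, Finset.HasAntidiagonal.mem_antidiagonal] at hp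
      rw [hm p.1 (by omega), hxy p.2 hp.2])
  have hcl' : ∀ k : ℕ, InClass (-k : ℤ) (m r k) ∧ InClass (-k : ℤ) (r k) := by
    intro k
    induction k using Nat.strong_induction_on with
    | _ k ih =>
      have hmk : ∀ i ≤ k, InClass (-i : ℤ) (m r i) := fun i hi => by
        cases i with
        | zero => simpa [m] using inClass_zero_one
        | succ i =>
          have := (hcl _ _ (ih i (by omega)).2).1
          convert this using 1
          push_cast
          ring
      refine ⟨hmk k le_rfl, ?_⟩
      rw [hr k]
      refine InClass.sub (((hmk k le_rfl).map (map_zero δ)).add (InClass.sum fun p hp => ?_))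
        (InClass.sum fun p hp => ?_)
      · rw [Finset.HasAntidiagonal.mem_antidiagonal] at hp
        have := (hU p.1).mul (hmk p.2 (by omega))
        convert this using 1
        rw [← hp]
        push_cast
        ring
      · rw [Finset.mem_filter, Finset.HasAntidiagonal.mem_antidiagonal] at hp
        have := (hmk p.1 (by omega)).mul (hcl _ _ (ih p.2 hp.2).2).2
        convert this using 1
        rw [← hp.1]
        push_cast
        ring
  refine ⟨PowerSeries.mk (m r), PowerSeries.mk fun k => π (r k), by simp [m], ?_,
    fun k => by simpa using hπ (r k), fun k => by simpa using (hcl' k).1⟩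
  ext1 k
  rw [add_mul, mul_add, ← mul_assoc, PowerSeries.X_mul (φ := PowerSeries.mk (m r)) |>.symm,
    mul_assoc, mul_assoc]
  cases k with
  | zero => simp [m]
  | succ k =>
    simp only [map_add, PowerSeries.coeff_succ_X_mul, PowerSeries.coeff_C_mul,
      PowerSeries.coeff_mul_C, PowerSeries.coeff_mk]
    have h1 : PowerSeries.coeff k (PowerSeries.mk (m r) * PowerSeries.mk fun k => π (r k)) =
        ∑ p ∈ Finset.HasAntidiagonal.antidiagonal k with p.2 < k, m r p.1 * π (r p.2) +
          π (r k) := by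
      rw [PowerSeries.coeff_mul, ← Finset.sum_filter_add_sum_filter_not _ fun p : ℕ × ℕ => p.2 < k]
      have : (Finset.HasAntidiagonal.antidiagonal k).filter (fun p => ¬ p.2 < k) = {(0, k)} := by
        ext p
        simp only [Finset.mem_filter, Finset.HasAntidiagonal.mem_antidiagonal,
          Finset.mem_singleton, Prod.ext_iff]
        omega
      rw [this]
      simp [m]
    have h2 := hSπ (r k)
    have h3 := hr k
    rw [h1, PowerSeries.coeff_mul]
    simp only [seriesDeriv, PowerSeries.coeff_mk]
    have h4 : m r (k + 1) = S (r k) := rfl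
    rw [h4]
    rw [sub_eq_iff_eq_add] at h2
    rw [h2]
    nth_rw 2 [h3]
    abel

/-- If `M` conjugates `s ∂ + L` to `s ∂ + K`, and the constant `Q` commutes with `K`, then
`M Q M⁻¹` commutes with `s ∂ + L`. -/
theorem dressed_commutes {L K M N Q : PowerSeries (Matrix (Fin n) (Fin n) R)}
    (hM : PowerSeries.X * seriesDeriv δ M + L * M = M * K) (hMN : M * N = 1) (hNM : N * M = 1)
    (hQ : seriesDeriv δ Q = 0) (hQK : Q * K = K * Q) :
    PowerSeries.X * seriesDeriv δ (M * Q * N) + (L * (M * Q * N) - M * Q * N * L) = 0 := by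
  set Y := M * Q * N with hY
  have h1 : Y * M = M * Q := by rw [hY, mul_assoc, hNM, mul_one]
  have h2 := congrArg (fun f => PowerSeries.X * seriesDeriv δ f) h1
  simp only [seriesDeriv_mul, hQ, mul_zero, add_zero, mul_add] at h2
  have hX : ∀ f g : PowerSeries (Matrix (Fin n) (Fin n) R),
      PowerSeries.X * (f * g) = f * (PowerSeries.X * g) := fun f g => by
    rw [← mul_assoc, PowerSeries.X_mul, mul_assoc]
  rw [hX Y, ← mul_assoc, ← mul_assoc PowerSeries.X _ Q, eq_sub_of_add_eq hM] at h2
  have h3 : (PowerSeries.X * seriesDeriv δ Y + (L * Y - Y * L)) * M = 0 := by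
    have e1 : Y * (M * K - L * M) = M * K * Q - Y * L * M := by
      rw [mul_sub, ← mul_assoc, h1, mul_assoc M Q K, hQK, ← mul_assoc, ← mul_assoc]
    have e2 : (M * K - L * M) * Q = M * K * Q - L * Y * M := by
      rw [sub_mul, mul_assoc L M Q, ← h1, ← mul_assoc]
    rw [e1, e2, ← eq_sub_iff_add_eq] at h2
    rw [add_mul, sub_mul, h2]
    abel
  calc _ = (PowerSeries.X * seriesDeriv δ Y + (L * Y - Y * L)) * M * N := by
        rw [mul_assoc _ M N, hMN, mul_one]
    _ = 0 := by rw [h3, zero_mul]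

theorem trace_coeff_mul_comm (f g : PowerSeries (Matrix (Fin n) (Fin n) R)) (k : ℕ) :
    (PowerSeries.coeff k (f * g)).trace = (PowerSeries.coeff k (g * f)).trace := by
  rw [PowerSeries.coeff_mul, PowerSeries.coeff_mul, Matrix.trace_sum, Matrix.trace_sum,
    ← Finset.sum_equiv (Equiv.prodComm ℕ ℕ) (t := Finset.HasAntidiagonal.antidiagonal k)
      (f := fun p => (PowerSeries.coeff p.2 f * PowerSeries.coeff p.1 g).trace)]
  · exact Finset.sum_congr rfl fun p _ => Matrix.trace_mul_comm _ _
  · intro p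
    simp [add_comm]
  · intro p _
    rfl

variable (δ) in
/-- There is a formal series `y = P + O(s)` whose powers commute with `s ∂ + P + s U`, with
`yⁿ = 1`. It is the conjugate of the cyclic shift `P` by the dressing series. -/
theorem exists_dressed_shift [Algebra ℚ R] (hn : 0 < n)
    (U : PowerSeries (Matrix (Fin n) (Fin n) R)) (hU : InClassSeries 0 U) :
    ∃ y : PowerSeries (Matrix (Fin n) (Fin n) R),
      PowerSeries.coeff 0 y = circ n R 1 ∧ y ^ n = 1 ∧ InClassSeries 1 y ∧
      ∀ j : ℕ,
        PowerSeries.X * seriesDeriv δ (y ^ j) +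
          ((PowerSeries.C (circ n R 1) + PowerSeries.X * U) * y ^ j -
            y ^ j * (PowerSeries.C (circ n R 1) + PowerSeries.X * U)) = 0 ∧
        (¬ n ∣ j → ∀ k, (PowerSeries.coeff k (y ^ j)).trace = 0) := by
  obtain ⟨M, F, hM0, hM, hF, hMc⟩ := exists_dressing (δ := δ) hn U hU
  set N := PowerSeries.invOfUnit M 1
  have hM1 : PowerSeries.constantCoeff M = ((1 : (Matrix (Fin n) (Fin n) R)ˣ) :
      Matrix (Fin n) (Fin n) R) := by simpa using hM0
  have hMN : M * N = 1 := PowerSeries.mul_invOfUnit M 1 hM1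
  have hNM : N * M = 1 := PowerSeries.invOfUnit_mul M 1 hM1
  have hpow : ∀ j : ℕ, (M * PowerSeries.C (circ n R 1) * N) ^ j =
      M * PowerSeries.C (circ n R j) * N := fun j => by
    induction j with
    | zero => simp [circ_zero, hMN]
    | succ j ih =>
      have : circ n R ((j + 1 : ℕ) : ℤ) = circ n R j * circ n R 1 := by
        rw [circ_mul hn]; push_cast; rfl
      rw [pow_succ, ih, this, map_mul]
      calc _ = M * PowerSeries.C (circ n R j) * (N * M) * PowerSeries.C (circ n R 1) * N := by
            simp only [mul_assoc]
        _ = _ := by simp only [hNM, mul_one, mul_assoc]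
  refine ⟨M * PowerSeries.C (circ n R 1) * N, ?_, ?_, ?_, fun j => ⟨?_, fun hj k => ?_⟩⟩
  · have hN0 : PowerSeries.coeff 0 N = 1 := by
      simp [N, PowerSeries.constantCoeff_invOfUnit]
    simp only [PowerSeries.coeff_mul, Finset.HasAntidiagonal.antidiagonal_zero,
      Finset.sum_singleton]
    simp [hN0, hM1]
  · rw [hpow, circ_self]
    simp [hMN]
  · have := (hMc.mul (inClassSeries_C_circ 1)).mul (hMc.of_mul_eq_one hM0 hMN)
    simpa using this
  · rw [hpow]
    refine dressed_commutes hM hMN hNM (seriesDeriv_C_circ δ _) ?_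
    have hc : ∀ f : PowerSeries (Matrix (Fin n) (Fin n) R),
        (∀ k, circ n R 1 * PowerSeries.coeff k f = PowerSeries.coeff k f * circ n R 1) →
        Commute (PowerSeries.C (circ n R 1)) f := fun f hf => by
      ext1 k
      rw [PowerSeries.coeff_C_mul, PowerSeries.coeff_mul_C, hf]
    have h1 : Commute (PowerSeries.C (circ n R 1)) (PowerSeries.C (circ n R 1) +
        PowerSeries.X * F) :=
      (Commute.refl _).add_right ((PowerSeries.commute_X _).mul_right (hc F hF))
    have h2 := h1.pow_left j
    rw [← map_pow, circ_pow hn, mul_one] at h2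
    exact h2
  · rw [hpow, mul_assoc, trace_coeff_mul_comm, mul_assoc, hNM, mul_one, PowerSeries.coeff_C]
    split_ifs
    · exact trace_circ (by exact_mod_cast hj)
    · simp

end Dressing

/-! ### The principal grading of the loop algebra -/

section Principal

variable {n : ℕ} {R : Type*} [CommRing R]

/-- The diagonal matrix with entries `s ^ (a i)`, as a Laurent series in `s`. -/
noncomputable def diagPow (R : Type*) [CommRing R] (a : Fin n → ℤ) :
    LaurentSeries (Matrix (Fin n) (Fin n) R) :=
  ∑ i : Fin n, HahnSeries.single (a i) (Matrix.single i i 1)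

theorem coeff_diagPow_mul (a : Fin n → ℤ) (X : LaurentSeries (Matrix (Fin n) (Fin n) R)) (e : ℤ)
    (i k : Fin n) : (diagPow R a * X).coeff e i k = X.coeff (e - a i) i k := by
  rw [diagPow, Finset.sum_mul, HahnSeries.coeff_sum, Matrix.sum_apply,
    Finset.sum_eq_single i]
  · rw [HahnSeries.coeff_single_mul, Matrix.single_mul_apply_same, one_mul]
  · intro l _ hl
    rw [HahnSeries.coeff_single_mul, Matrix.single_mul_apply_of_ne]
    exact hl.symm
  · simp

theorem coeff_mul_diagPow (a : Fin n → ℤ) (X : LaurentSeries (Matrix (Fin n) (Fin n) R)) (e : ℤ)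
    (i k : Fin n) : (X * diagPow R a).coeff e i k = X.coeff (e - a k) i k := by
  rw [diagPow, Finset.mul_sum, HahnSeries.coeff_sum, Matrix.sum_apply,
    Finset.sum_eq_single k]
  · rw [HahnSeries.coeff_mul_single, Matrix.mul_single_apply_same, mul_one]
  · intro l _ hl
    rw [HahnSeries.coeff_mul_single, Matrix.mul_single_apply_of_ne]
    exact hl.symm
  · simp

theorem diagPow_mul_diagPow {a b : Fin n → ℤ} (h : ∀ i, a i + b i = 0) :
    diagPow R a * diagPow R b = 1 := by
  ext e i k
  rw [coeff_diagPow_mul]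
  have h1 := coeff_mul_diagPow (R := R) b 1 (e - a i) i k
  rw [one_mul] at h1
  rw [h1]
  simp only [HahnSeries.coeff_one]
  by_cases hik : i = k
  · subst hik
    have : e - a i - b i = 0 ↔ e = 0 := by have := h i; omega
    by_cases he : e = 0
    · rw [if_pos he, if_pos (this.2 he)]
    · rw [if_neg he, if_neg (mt this.1 he)]
  · split_ifs <;> simp [hik]

/-- The ring homomorphism `X(λ) ↦ D X(μⁿ) D⁻¹`, with `D = diag(1, μ, …, μ^{n-1})`, as Laurent
series in `s = μ⁻¹`. It turns the principal grading into the grading by powers of `μ`. -/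
noncomputable def principal (hn : 0 < n) :
    LaurentSeries (Matrix (Fin n) (Fin n) R) →+* LaurentSeries (Matrix (Fin n) (Fin n) R) where
  toFun X := diagPow R (fun i => -(i : ℤ)) *
    HahnSeries.embDomainRingHom (AddMonoidHom.mulLeft (n : ℤ))
      (mul_right_injective₀ (by exact_mod_cast hn.ne'))
      (fun _ _ => mul_le_mul_iff_right₀ (by exact_mod_cast hn)) X *
    diagPow R (fun i => (i : ℤ))
  map_zero' := by simp
  map_add' X Y := by rw [map_add, mul_add, add_mul]
  map_one' := by rw [map_one, mul_one, diagPow_mul_diagPow (by simp)]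
  map_mul' X Y := by
    have h : diagPow R (fun i : Fin n => (i : ℤ)) * diagPow R (fun i : Fin n => -(i : ℤ)) = 1 :=
      diagPow_mul_diagPow (by simp)
    rw [map_mul]
    simp only [mul_assoc]
    rw [← mul_assoc (diagPow R fun i : Fin n => (i : ℤ)), h, one_mul]

theorem coeff_principal (hn : 0 < n) (X : LaurentSeries (Matrix (Fin n) (Fin n) R)) (e : ℤ)
    (i k : Fin n) : (principal hn X).coeff e i k =
      if (n : ℤ) ∣ e + i - k then X.coeff ((e + i - k) / n) i k else 0 := by
  change (diagPow R _ * _ * diagPow R _).coeff e i k = _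
  rw [coeff_mul_diagPow, coeff_diagPow_mul]
  have he : e - (k : ℤ) - -(i : ℤ) = e + i - k := by ring
  rw [he]
  change (HahnSeries.embDomain _ X).coeff _ i k = _
  split_ifs with h
  · obtain ⟨m, hm⟩ := h
    rw [hm, Int.mul_ediv_cancel_left _ (by exact_mod_cast hn.ne')]
    exact congrFun (congrFun (HahnSeries.embDomain_coeff
      (f := ⟨⟨AddMonoidHom.mulLeft (n : ℤ), _⟩, _⟩)) i) k
  · rw [HahnSeries.embDomain_of_notMem_range]
    · rfl
    · rintro ⟨m, hm⟩
      exact h ⟨m, hm.symm⟩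

/-- The coefficients of `X` can be read off from those of `principal X`. -/
theorem coeff_eq_coeff_principal (hn : 0 < n) (X : LaurentSeries (Matrix (Fin n) (Fin n) R))
    (m : ℤ) (i k : Fin n) : X.coeff m i k = (principal hn X).coeff (n * m - i + k) i k := by
  rw [coeff_principal]
  have : (n : ℤ) * m - i + k + i - k = n * m := by ring
  rw [this, if_pos (dvd_mul_right _ _), Int.mul_ediv_cancel_left _ (by exact_mod_cast hn.ne')]

theorem principal_injective (hn : 0 < n) :
    Function.Injective (principal (R := R) hn) := fun X Y h => by
  ext m i k
  rw [coeff_eq_coeff_principal hn, h, ← coeff_eq_coeff_principal]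

/-- The image of `principal`: series whose coefficient of `s ^ e` is supported on the cyclic
diagonal `-e`. -/
theorem exists_principal_eq (hn : 0 < n) (W : LaurentSeries (Matrix (Fin n) (Fin n) R))
    (hW : ∀ e, InClass (-e) (W.coeff e)) : ∃ X, principal hn X = W := by
  have hn' : (0 : ℤ) < n := by exact_mod_cast hn
  obtain ⟨N, hN⟩ : ∃ N : ℕ, ∀ e : ℤ, e < -N → W.coeff e = 0 := by
    by_cases h0 : W = 0
    · exact ⟨0, fun e _ => by simp [h0]⟩
    · refine ⟨W.order.natAbs, fun e he => HahnSeries.coeff_eq_zero_of_lt_order ?_⟩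
      omega
  refine ⟨HahnSeries.ofSuppBddBelow
    (fun m => Matrix.of fun i k => W.coeff (n * m - i + k) i k) ⟨-N - 1, fun m hm => ?_⟩, ?_⟩
  · by_contra hlt
    refine hm ?_
    ext i k
    have : (n : ℤ) * m - i + k < -N := by
      have := k.2
      nlinarith
    simp [hN _ this]
  · ext e i k
    rw [coeff_principal]
    split_ifs with h
    · change W.coeff (n * ((e + i - k) / n) - i + k) i k = _
      rw [Int.mul_ediv_cancel' h, show e + (i : ℤ) - k - i + k = e by ring]
    · exact (hW e i k fun h' => h (by convert h' using 1; ring)).symm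

theorem coeff_principal_single (hn : 0 < n) (m : ℤ) (A : Matrix (Fin n) (Fin n) R) (e : ℤ)
    (i k : Fin n) : (principal hn (HahnSeries.single m A)).coeff e i k =
      if e = n * m - i + k then A i k else 0 := by
  have hn' : (n : ℤ) ≠ 0 := by exact_mod_cast hn.ne'
  rw [coeff_principal, HahnSeries.coeff_single]
  by_cases he : e = n * m - i + k
  · have h1 : e + i - k = n * m := by rw [he]; ring
    rw [h1, Int.mul_ediv_cancel_left _ hn', if_pos (dvd_mul_right _ _), if_pos rfl, if_pos he]
  · rw [if_neg he]
    split_ifs with h1 h2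
    · exact absurd (by rw [← h2, Int.mul_ediv_cancel' h1]; ring) he
    · rfl
    · rfl

theorem principal_single_one (hn : 0 < n) (m : ℤ) :
    principal hn (HahnSeries.single m (1 : Matrix (Fin n) (Fin n) R)) =
      HahnSeries.single (n * m) 1 := by
  ext e i k
  rw [coeff_principal_single, HahnSeries.coeff_single]
  by_cases hik : i = k
  · subst hik
    rw [sub_add_cancel]
    split_ifs <;> rfl
  · split_ifs <;> simp [hik]

/-- `b = ∑ e_{i+1,i}` over the ring `R`. -/
def bMatR (n : ℕ) (R : Type*) [CommRing R] : Matrix (Fin n) (Fin n) R :=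
  Matrix.of fun i k => if (i : ℕ) = (k : ℕ) + 1 then 1 else 0

/-- `e_{1n}` over the ring `R`. -/
def cornerMatR (n : ℕ) (R : Type*) [CommRing R] : Matrix (Fin n) (Fin n) R :=
  Matrix.of fun i k => if (i : ℕ) = 0 ∧ (k : ℕ) + 1 = n then 1 else 0

/-- `u ∈ ⊕_{i=1}^{n-1} R e_{in}`. -/
def InVR (u : Matrix (Fin n) (Fin n) R) : Prop :=
  ∀ i k : Fin n, ¬ ((k : ℕ) + 1 = n ∧ (i : ℕ) + 1 < n) → u i k = 0

/-- The loop `J + u = e_{1n} λ + b + u`. -/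
noncomputable def laxMat (u : Matrix (Fin n) (Fin n) R) :
    LaurentSeries (Matrix (Fin n) (Fin n) R) :=
  HahnSeries.single (-1) (cornerMatR n R) + HahnSeries.single 0 (bMatR n R + u)

/-- The series `U` with `principal (J + u) = s⁻¹ P + U`. -/
noncomputable def potentialSeries (u : Matrix (Fin n) (Fin n) R) :
    PowerSeries (Matrix (Fin n) (Fin n) R) :=
  PowerSeries.mk fun e => Matrix.of fun i k => if (k : ℤ) - i = e then u i k else 0

theorem inClassSeries_potentialSeries (u : Matrix (Fin n) (Fin n) R) :
    InClassSeries 0 (potentialSeries u) := fun e i k h => by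
  rw [potentialSeries, PowerSeries.coeff_mk, of_apply, if_neg]
  intro h'
  exact h (by rw [← h']; simp)

theorem coeff_ofPowerSeries_of_neg {A : Type*} [Semiring A] (f : PowerSeries A) {e : ℤ}
    (he : e < 0) : (HahnSeries.ofPowerSeries ℤ A f).coeff e = 0 := by
  rw [HahnSeries.ofPowerSeries_apply, HahnSeries.embDomain_of_notMem_range]
  rintro ⟨m, hm⟩
  have : (m : ℤ) = e := hm
  omega

/-- The principal grading turns `J` into the cyclic shift `P` times `s⁻¹`, while `u` only
contributes non-negative powers of `s`. -/
theorem principal_laxMat (hn : 2 ≤ n) {u : Matrix (Fin n) (Fin n) R} (hu : InVR u) :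
    principal (by omega) (laxMat u) = HahnSeries.single (-1) 1 * HahnSeries.ofPowerSeries ℤ _
      (PowerSeries.C (circ n R 1) + PowerSeries.X * potentialSeries u) := by
  have hn' : (n : ℤ) ≠ 0 := by omega
  rw [map_add, map_mul, HahnSeries.ofPowerSeries_X, HahnSeries.ofPowerSeries_C, mul_add,
    ← mul_assoc, HahnSeries.single_mul_single, neg_add_cancel, mul_one, HahnSeries.single_zero_one,
    one_mul, HahnSeries.C_apply, HahnSeries.single_mul_single, add_zero, one_mul]
  rw [laxMat, HahnSeries.single_add, ← add_assoc, map_add]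
  congr 1
  · ext e i k
    rw [map_add, HahnSeries.coeff_add, Matrix.add_apply, coeff_principal_single,
      coeff_principal_single]
    have hi := i.2
    have hk := k.2
    have hdvd : (n : ℤ) ∣ (i : ℤ) - k - 1 ↔ (i : ℕ) = k + 1 ∨ ((i : ℕ) = 0 ∧ (k : ℕ) + 1 = n) := by
      constructor
      · rintro ⟨c, hc⟩
        have h1 : c < 1 := by
          by_contra hc1
          nlinarith
        have h2 : -2 < c := by
          by_contra hc1
          nlinarith
        obtain rfl | rfl : c = 0 ∨ c = -1 := by omega
        · left; omega
        · right; omega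
      · rintro (h | ⟨h1, h2⟩)
        · exact ⟨0, by omega⟩
        · exact ⟨-1, by omega⟩
    have hR : (HahnSeries.single (-1) (circ n R 1)).coeff e i k =
        if e = -1 ∧ ((i : ℕ) = k + 1 ∨ ((i : ℕ) = 0 ∧ (k : ℕ) + 1 = n)) then 1 else 0 := by
      rw [HahnSeries.coeff_single]
      by_cases he : e = -1 <;> simp [he, circ, hdvd]
    rw [hR]
    simp only [cornerMatR, bMatR, of_apply]
    by_cases h1 : (i : ℕ) = k + 1
    · have h2 : ¬ ((i : ℕ) = 0 ∧ (k : ℕ) + 1 = n) := by omega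
      have h3 : e = n * 0 - (i : ℤ) + k ↔ e = -1 := by omega
      simp only [if_neg h2, if_pos h1, ite_self, zero_add, h3, or_iff_left h2, and_iff_left h1]
    · by_cases h2 : (i : ℕ) = 0 ∧ (k : ℕ) + 1 = n
      · have h3 : e = n * (-1) - (i : ℤ) + k ↔ e = -1 := by omega
        simp only [if_neg h1, if_pos h2, ite_self, add_zero, h3, or_iff_right h1, and_iff_left h2]
      · simp [h1, h2]
  · ext e i k
    rw [coeff_principal_single]
    obtain he | ⟨m, rfl⟩ : e < 0 ∨ ∃ m : ℕ, e = m := by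
      rcases lt_or_ge e 0 with h | h
      · exact Or.inl h
      · exact Or.inr ⟨e.toNat, by omega⟩
    · rw [coeff_ofPowerSeries_of_neg _ he]
      split_ifs with h
      · exact hu i k (by omega)
      · rfl
    · rw [HahnSeries.ofPowerSeries_apply_coeff, potentialSeries, PowerSeries.coeff_mk, of_apply]
      have : (m : ℤ) = n * 0 - (i : ℤ) + k ↔ (k : ℤ) - i = m := by omega
      simp only [this]

end Principal

/-! ### Existence and uniqueness of the `n`-th root `Y` -/

section Root

variable {n : ℕ} {R : Type*} [CommRing R] (δ : Derivation ℤ R R)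

/-- `Y = e_{1n} λ + O(1)` commutes with `∂ + J + u` and satisfies `Yⁿ = λ`, over a differential
ring `R`. Laurent series are in the variable `λ⁻¹`. -/
structure IsLaxRoot (u : Matrix (Fin n) (Fin n) R)
    (Y : LaurentSeries (Matrix (Fin n) (Fin n) R)) : Prop where
  leading : Y.coeff (-1) = cornerMatR n R
  bounded : ∀ k < -1, Y.coeff k = 0
  commutes : ∀ k, (Y.coeff k).map δ + (laxMat u * Y - Y * laxMat u).coeff k = 0
  pow_eq : Y ^ n = HahnSeries.single (-1) 1

theorem map_derivation_coeff_ofPowerSeries (f : PowerSeries (Matrix (Fin n) (Fin n) R)) (e : ℤ) :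
    ((HahnSeries.ofPowerSeries ℤ _ f).coeff e).map δ =
      (HahnSeries.ofPowerSeries ℤ _ (PowerSeries.X * seriesDeriv δ f)).coeff (e + 1) := by
  have h0 : (0 : Matrix (Fin n) (Fin n) R).map δ = 0 := by ext; simp
  rcases lt_or_ge e 0 with h | h
  · rw [coeff_ofPowerSeries_of_neg _ h, h0]
    rcases lt_or_ge (e + 1) 0 with h1 | h1
    · rw [coeff_ofPowerSeries_of_neg _ h1]
    · have : e + 1 = ((0 : ℕ) : ℤ) := by omega
      rw [this, HahnSeries.ofPowerSeries_apply_coeff, PowerSeries.coeff_zero_X_mul]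
  · obtain ⟨m, rfl⟩ : ∃ m : ℕ, e = m := ⟨e.toNat, by omega⟩
    have : (m : ℤ) + 1 = ((m + 1 : ℕ) : ℤ) := by push_cast; rfl
    rw [this, HahnSeries.ofPowerSeries_apply_coeff, HahnSeries.ofPowerSeries_apply_coeff,
      PowerSeries.coeff_succ_X_mul, seriesDeriv, PowerSeries.coeff_mk]

theorem commute_single_one {A : Type*} [Ring A] (k : ℤ) (x : LaurentSeries A) :
    Commute (HahnSeries.single k (1 : A)) x := by
  ext e
  rw [HahnSeries.coeff_single_mul, HahnSeries.coeff_mul_single, one_mul, mul_one]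

/-- The root `Y` is the preimage under `principal` of `s⁻¹ y`, with `y` the dressed cyclic shift.
The powers `Y ^ j` inherit from `y ^ j` the Lax equation and, unless `n ∣ j`, the vanishing of the
trace. -/
theorem exists_isLaxRoot [Algebra ℚ R] (hn : 2 ≤ n) {u : Matrix (Fin n) (Fin n) R} (hu : InVR u) :
    ∃ Y, IsLaxRoot δ u Y ∧ ∀ j : ℕ,
      (∀ k, ((Y ^ j).coeff k).map δ + (laxMat u * Y ^ j - Y ^ j * laxMat u).coeff k = 0) ∧
      (¬ n ∣ j → ∀ k, ((Y ^ j).coeff k).trace = 0) := by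
  have hn0 : 0 < n := by omega
  obtain ⟨y, hy0, hyn, hyc, hy⟩ := exists_dressed_shift δ hn0 _ (inClassSeries_potentialSeries u)
  set W : LaurentSeries (Matrix (Fin n) (Fin n) R) :=
    HahnSeries.single (-1) 1 * HahnSeries.ofPowerSeries ℤ _ y with hW
  have hWe : ∀ e, W.coeff e = (HahnSeries.ofPowerSeries ℤ _ y).coeff (e + 1) := fun e => by
    rw [hW, HahnSeries.coeff_single_mul, one_mul, sub_neg_eq_add]
  have hWc : ∀ e, InClass (-e) (W.coeff e) := fun e => by
    rw [hWe]
    rcases lt_or_ge (e + 1) 0 with h | h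
    · rw [coeff_ofPowerSeries_of_neg _ h]
      exact fun _ _ _ => rfl
    · obtain ⟨m, hm⟩ : ∃ m : ℕ, e + 1 = m := ⟨(e + 1).toNat, by omega⟩
      rw [hm, HahnSeries.ofPowerSeries_apply_coeff]
      convert hyc m using 1
      omega
  obtain ⟨Y, hY⟩ := exists_principal_eq hn0 W hWc
  have hYj : ∀ j : ℕ, principal hn0 (Y ^ j) =
      HahnSeries.single (-(j : ℤ)) 1 * HahnSeries.ofPowerSeries ℤ _ (y ^ j) := fun j => by
    rw [map_pow, hY, hW, (commute_single_one _ _).mul_pow, HahnSeries.single_pow, one_pow, map_pow]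
    congr 3
    simp
  have hcomm : ∀ (j : ℕ) (k : ℤ),
      ((Y ^ j).coeff k).map δ + (laxMat u * Y ^ j - Y ^ j * laxMat u).coeff k = 0 := by
    intro j k
    ext i l
    rw [Matrix.add_apply, map_apply, coeff_eq_coeff_principal hn0 (Y ^ j),
      coeff_eq_coeff_principal hn0 (laxMat u * Y ^ j - Y ^ j * laxMat u), map_sub, map_mul, map_mul,
      principal_laxMat hn hu, hYj]
    generalize (n : ℤ) * k - i + l = e
    set K := PowerSeries.C (circ n R 1) + PowerSeries.X * potentialSeries u
    have h1 : HahnSeries.single (-1) 1 * HahnSeries.ofPowerSeries ℤ _ K *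
          (HahnSeries.single (-(j : ℤ)) 1 * HahnSeries.ofPowerSeries ℤ _ (y ^ j)) -
        HahnSeries.single (-(j : ℤ)) 1 * HahnSeries.ofPowerSeries ℤ _ (y ^ j) *
          (HahnSeries.single (-1) 1 * HahnSeries.ofPowerSeries ℤ _ K) =
        HahnSeries.single (-(j : ℤ) - 1) 1 *
          HahnSeries.ofPowerSeries ℤ _ (K * y ^ j - y ^ j * K) := by
      rw [mul_assoc, ← mul_assoc _ (HahnSeries.single (-(j : ℤ)) 1),
        ← (commute_single_one (-(j : ℤ)) (HahnSeries.ofPowerSeries ℤ _ K)).eq, mul_assoc,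
        ← mul_assoc, HahnSeries.single_mul_single, mul_assoc (HahnSeries.single (-(j : ℤ)) 1),
        ← mul_assoc _ (HahnSeries.single (-1) 1),
        ← (commute_single_one (-1) (HahnSeries.ofPowerSeries ℤ _ (y ^ j))).eq, mul_assoc,
        ← mul_assoc (HahnSeries.single (-(j : ℤ)) 1), HahnSeries.single_mul_single, mul_one,
        map_sub, map_mul, map_mul, mul_sub]
      congr 4
      ring
    have h2 := congrArg (HahnSeries.ofPowerSeries ℤ _) (hy j).1
    have h3 := congrArg (fun f => f.coeff (e + j + 1) i l) h2
    rw [h1, HahnSeries.coeff_single_mul, HahnSeries.coeff_single_mul, one_mul, one_mul,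
      sub_neg_eq_add, show e - (-(j : ℤ) - 1) = e + j + 1 by ring,
      ← map_apply (f := δ) (i := i) (j := l), map_derivation_coeff_ofPowerSeries]
    simp only [map_add, HahnSeries.coeff_add, Matrix.add_apply, map_zero] at h3
    exact h3
  refine ⟨Y, ⟨?_, ?_, ?_, ?_⟩, fun j => ⟨hcomm j, fun hj k => ?_⟩⟩
  · ext i k
    rw [coeff_eq_coeff_principal hn0, hY, hWe]
    have hi := i.2
    have hk := k.2
    rcases lt_or_ge ((n : ℤ) * (-1) - i + k + 1) 0 with h | h
    · rw [coeff_ofPowerSeries_of_neg _ h]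
      rw [cornerMatR, of_apply, if_neg (by omega)]
      rfl
    · have h0 : (n : ℤ) * (-1) - i + k + 1 = ((0 : ℕ) : ℤ) := by omega
      rw [h0, HahnSeries.ofPowerSeries_apply_coeff, hy0, cornerMatR, of_apply, if_pos (by omega),
        circ, of_apply, if_pos ⟨-1, by omega⟩]
  · intro m hm
    ext i k
    rw [coeff_eq_coeff_principal hn0, hY, hWe, coeff_ofPowerSeries_of_neg]
    have hk := k.2
    have : (n : ℤ) * m ≤ n * (-2) := mul_le_mul_of_nonneg_left (by omega) (by omega)
    omega
  · simpa using hcomm 1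
  · refine principal_injective hn0 ?_
    rw [hYj, hyn, (HahnSeries.ofPowerSeries ℤ _).map_one, mul_one, principal_single_one, mul_neg,
      mul_one]
  · have htr : ((Y ^ j).coeff k).trace =
        ((HahnSeries.ofPowerSeries ℤ _ (y ^ j)).coeff (n * k + j)).trace := by
      refine Finset.sum_congr rfl fun i _ => ?_
      rw [diag_apply, diag_apply, coeff_eq_coeff_principal hn0, hYj, HahnSeries.coeff_single_mul,
        one_mul, sub_add_cancel, sub_neg_eq_add]
    rw [htr]
    rcases lt_or_ge ((n : ℤ) * k + j) 0 with h | h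
    · rw [coeff_ofPowerSeries_of_neg _ h, trace_zero]
    · obtain ⟨m, hm⟩ : ∃ m : ℕ, (n : ℤ) * k + j = m := ⟨((n : ℤ) * k + j).toNat, by omega⟩
      rw [hm, HahnSeries.ofPowerSeries_apply_coeff, (hy j).2 hj]

/-- The coefficients of a product at and below the sum of two lower bounds for the exponents. -/
theorem coeff_mul_of_low {A : Type*} [Ring A] {x y : LaurentSeries A} {a b : ℤ}
    (hx : ∀ e < a, x.coeff e = 0) (hy : ∀ e < b, y.coeff e = 0) :
    (∀ e < a + b, (x * y).coeff e = 0) ∧ (x * y).coeff (a + b) = x.coeff a * y.coeff b := by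
  constructor
  · intro e he
    rw [HahnSeries.coeff_mul]
    refine Finset.sum_eq_zero fun p hp => ?_
    rw [Finset.mem_antidiagonal] at hp
    rcases lt_or_ge p.1 a with h | h
    · rw [hx _ h, zero_mul]
    · rw [hy _ (by omega), mul_zero]
  · rw [HahnSeries.coeff_mul, Finset.sum_eq_single (a, b)]
    · intro p hp hne
      rw [Finset.mem_antidiagonal] at hp
      rcases lt_or_ge p.1 a with h | h
      · rw [hx _ h, zero_mul]
      · rcases lt_or_ge p.2 b with h' | h'
        · rw [hy _ h', mul_zero]
        · exact absurd (Prod.ext (by omega) (by omega)) hne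
    · intro h
      rw [Finset.mem_antidiagonal] at h
      by_cases h1 : x.coeff a = 0
      · rw [h1, zero_mul]
      · by_cases h2 : y.coeff b = 0
        · rw [h2, mul_zero]
        · exact absurd ⟨h1, h2, rfl⟩ h

theorem coeff_pow_of_low {A : Type*} [Ring A] {x : LaurentSeries A} {a : ℤ}
    (hx : ∀ e < a, x.coeff e = 0) (j : ℕ) :
    (∀ e < j * a, (x ^ j).coeff e = 0) ∧ (x ^ j).coeff (j * a) = x.coeff a ^ j := by
  induction j with
  | zero =>
    constructor
    · intro e he
      have : e ≠ 0 := by omega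
      simp [HahnSeries.coeff_one, this]
    · simp
  | succ j ih =>
    have h := coeff_mul_of_low ih.1 hx
    have e1 : ((j + 1 : ℕ) : ℤ) * a = j * a + a := by push_cast; ring
    rw [e1, pow_succ, pow_succ, ← ih.2]
    exact h

variable {δ}

theorem principal_laxMat_low (hn : 2 ≤ n) {u : Matrix (Fin n) (Fin n) R} (hu : InVR u) :
    (∀ e < -1, (principal (by omega) (laxMat u)).coeff e = 0) ∧
      (principal (by omega) (laxMat u)).coeff (-1) = circ n R 1 := by
  rw [principal_laxMat hn hu]
  constructor
  · intro e he
    rw [HahnSeries.coeff_single_mul, one_mul, coeff_ofPowerSeries_of_neg _ (by omega)]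
  · rw [HahnSeries.coeff_single_mul, one_mul, sub_self]
    have := HahnSeries.ofPowerSeries_apply_coeff (Γ := ℤ)
      (PowerSeries.C (circ n R 1) + PowerSeries.X * potentialSeries u) 0
    rw [Nat.cast_zero] at this
    rw [this]
    simp

/-- The lowest coefficient of a series that commutes with `∂ + J + u` commutes with the cyclic
shift. -/
theorem commute_lowest_coeff (hn : 2 ≤ n) {u : Matrix (Fin n) (Fin n) R} (hu : InVR u)
    {X : LaurentSeries (Matrix (Fin n) (Fin n) R)}
    (hX : ∀ k, (X.coeff k).map δ + (laxMat u * X - X * laxMat u).coeff k = 0) {e : ℤ}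
    (he : ∀ e' < e, (principal (by omega) X).coeff e' = 0) :
    circ n R 1 * (principal (by omega) X).coeff e =
      (principal (by omega) X).coeff e * circ n R 1 := by
  have hn0 : 0 < n := by omega
  have h1 : ((principal hn0 X).coeff (e - 1)).map δ +
      (principal hn0 (laxMat u * X - X * laxMat u)).coeff (e - 1) = 0 := by
    ext i l
    rw [Matrix.add_apply, map_apply, coeff_principal, coeff_principal]
    split_ifs
    · exact congrFun (congrFun (hX _) i) l
    · simp
  have h2 := coeff_mul_of_low (principal_laxMat_low hn hu).1 he
  have h3 := coeff_mul_of_low he (principal_laxMat_low hn hu).1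
  have h0 : (0 : Matrix (Fin n) (Fin n) R).map δ = 0 := by ext; simp
  rw [he _ (by omega), h0, zero_add, map_sub, map_mul, map_mul, HahnSeries.coeff_sub,
    show e - 1 = -1 + e by ring, h2.2, show -1 + e = e + -1 by ring, h3.2,
    (principal_laxMat_low hn hu).2] at h1
  exact sub_eq_zero.1 h1

theorem inClass_coeff_principal (hn : 0 < n) (X : LaurentSeries (Matrix (Fin n) (Fin n) R))
    (e : ℤ) : InClass (-e) ((principal hn X).coeff e) := fun i k h => by
  rw [coeff_principal, if_neg]
  intro h'
  exact h (by convert h' using 1; ring)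

/-- In the principal grading, `Y` starts with the cyclic shift `P s⁻¹`: a lower leading
coefficient would be a scalar multiple of a power of `P` and nilpotent. -/
theorem IsLaxRoot.principal_low [IsReduced R] (hn : 2 ≤ n) {u : Matrix (Fin n) (Fin n) R}
    (hu : InVR u) {Y : LaurentSeries (Matrix (Fin n) (Fin n) R)} (hY : IsLaxRoot δ u Y) :
    (∀ e < -1, (principal (by omega) Y).coeff e = 0) ∧
      (principal (by omega) Y).coeff (-1) = circ n R 1 := by
  have hn0 : 0 < n := by omega
  -- The entries of `e_{1n} λ` and of the lower powers of `λ` have principal exponent at least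
  -- `1 - n`; the exponents `1 - n, …, -2` are excluded one after the other.
  have hlow : ∀ t : ℕ, ∀ e < -(n : ℤ) + 1 + t, e < -1 → (principal hn0 Y).coeff e = 0 := by
    intro t
    induction t with
    | zero =>
      intro e he he1
      ext i k
      rw [coeff_principal]
      split_ifs with h
      · obtain ⟨m, hm⟩ := h
        have hi := i.2
        have hk := k.2
        rw [hm, Int.mul_ediv_cancel_left _ (by omega)]
        have hm0 : m < 0 := by
          by_contra hm0
          have : 0 ≤ (n : ℤ) * m := mul_nonneg (by omega) (by omega)
          omega
        rcases lt_or_ge m (-1) with hm1 | hm1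
        · rw [hY.bounded m hm1]
        · obtain rfl : m = -1 := by omega
          rw [hY.leading, cornerMatR, of_apply, if_neg (by omega)]
          rfl
      · rfl
    | succ t ih =>
      intro e he he1
      have hbelow : ∀ e' < e, (principal hn0 Y).coeff e' = 0 := fun e' he' =>
        ih e' (by push_cast at he; omega) (by omega)
      obtain ⟨r, hr⟩ := (inClass_coeff_principal hn0 Y e).eq_smul_circ hn0
        (commute_lowest_coeff hn hu hY.commutes hbelow)
      have h1 := (coeff_pow_of_low hbelow n).2
      have hne : (n : ℤ) * e ≠ n * -1 := fun h => by
        have := mul_left_cancel₀ (show (n : ℤ) ≠ 0 by omega) h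
        omega
      rw [← map_pow, hY.pow_eq, principal_single_one, HahnSeries.coeff_single, if_neg hne, hr,
        smul_pow, circ_pow hn0] at h1
      obtain ⟨l, hl⟩ := exists_fin_dvd_sub hn0 (-(n * -e))
      have h2 := congrFun (congrFun h1 ⟨0, hn0⟩) l
      have hl' : (n : ℤ) ∣ 0 - l - n * -e := by convert hl using 1; ring
      simp only [circ, Matrix.smul_apply, of_apply, Matrix.zero_apply, Nat.cast_zero, hl', if_true,
        smul_eq_mul, mul_one] at h2
      have hr0 : r = 0 := eq_zero_of_pow_eq_zero h2.symm
      rw [hr, hr0, zero_smul]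
  have hbelow : ∀ e < -1, (principal hn0 Y).coeff e = 0 := fun e he =>
    hlow n e (by omega) he
  refine ⟨hbelow, ?_⟩
  obtain ⟨r, hr⟩ := (inClass_coeff_principal hn0 Y (-1)).eq_smul_circ hn0
    (commute_lowest_coeff hn hu hY.commutes hbelow)
  have h1 : (principal hn0 Y).coeff (-1) ⟨0, hn0⟩ ⟨n - 1, by omega⟩ = 1 := by
    have hm : (-1 : ℤ) + (0 : ℕ) - (n - 1 : ℕ) = n * -1 := by push_cast [hn0]; ring
    rw [coeff_principal]
    simp only [hm]
    rw [if_pos (dvd_mul_right _ _), Int.mul_ediv_cancel_left _ (by omega), hY.leading, cornerMatR,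
      of_apply, if_pos ⟨rfl, by simp only; omega⟩]
  have h2 : (n : ℤ) ∣ ((0 : ℕ) : ℤ) - (n - 1 : ℕ) - -(-1) := ⟨-1, by push_cast [hn0]; ring⟩
  rw [hr] at h1
  simp only [circ, Matrix.smul_apply, of_apply, h2, if_true, smul_eq_mul, mul_one] at h1
  rw [hr, h1, one_smul, neg_neg]

/-- Two roots coincide: if `D` is the lowest coefficient of their difference in the principal
grading, then `Y₁ⁿ - Y₂ⁿ = 0` has the lowest coefficient `n D Pⁿ⁻¹`, because `D` commutes with the
cyclic shift `P`. -/
theorem IsLaxRoot.unique [IsReduced R] [Algebra ℚ R] (hn : 2 ≤ n) {u : Matrix (Fin n) (Fin n) R}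
    (hu : InVR u) {Y₁ Y₂ : LaurentSeries (Matrix (Fin n) (Fin n) R)} (h₁ : IsLaxRoot δ u Y₁)
    (h₂ : IsLaxRoot δ u Y₂) : Y₁ = Y₂ := by
  have hn0 : 0 < n := by omega
  obtain ⟨l₁, c₁⟩ := h₁.principal_low hn hu
  obtain ⟨l₂, c₂⟩ := h₂.principal_low hn hu
  by_contra hne
  set D := principal hn0 (Y₁ - Y₂) with hD
  have hD0 : D ≠ 0 := fun h => hne <| sub_eq_zero.1 <| principal_injective hn0 <| by
    rw [map_zero, ← h]
  set e := D.order
  have he : ∀ e' < e, D.coeff e' = 0 := fun e' => HahnSeries.coeff_eq_zero_of_lt_order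
  have hDe : D.coeff e ≠ 0 := fun h => hD0 (HahnSeries.coeff_order_eq_zero.1 h)
  have hDc : ∀ k, ((Y₁ - Y₂).coeff k).map δ +
      (laxMat u * (Y₁ - Y₂) - (Y₁ - Y₂) * laxMat u).coeff k = 0 := fun k => by
    have h1 := h₁.commutes k
    have h2 := h₂.commutes k
    have h3 : ((Y₁ - Y₂).coeff k).map δ = (Y₁.coeff k).map δ - (Y₂.coeff k).map δ := by
      ext; simp
    rw [h3, ← sub_zero (0 : Matrix (Fin n) (Fin n) R)]
    nth_rw 2 [← h2]
    rw [← h1, mul_sub, sub_mul]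
    simp only [HahnSeries.coeff_sub]
    abel
  have hcomm : circ n R 1 * D.coeff e = D.coeff e * circ n R 1 :=
    commute_lowest_coeff hn hu hDc he
  -- the lowest coefficient of `Y₁ ^ (k + 1) - Y₂ ^ (k + 1)`, from a noncommutative telescoping sum
  have hpow : ∀ k : ℕ,
      (∀ e' < -(k : ℤ) + e, (principal hn0 (Y₁ ^ (k + 1) - Y₂ ^ (k + 1))).coeff e' = 0) ∧
      (principal hn0 (Y₁ ^ (k + 1) - Y₂ ^ (k + 1))).coeff (-(k : ℤ) + e) =
        ((k + 1 : ℕ) : ℚ) • (D.coeff e * circ n R k) := by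
    intro k
    induction k with
    | zero => simpa [circ_zero, ← hD] using he
    | succ k ih =>
      have h1 : Y₁ ^ (k + 1 + 1) - Y₂ ^ (k + 1 + 1) =
          Y₁ * (Y₁ ^ (k + 1) - Y₂ ^ (k + 1)) + (Y₁ - Y₂) * Y₂ ^ (k + 1) := by
        rw [pow_succ' Y₁ (k + 1), pow_succ' Y₂ (k + 1), mul_sub, sub_mul]
        abel
      have h2 := coeff_mul_of_low l₁ ih.1
      have h3 := coeff_mul_of_low he (coeff_pow_of_low l₂ (k + 1)).1
      have e2 : (-1 : ℤ) + (-(k : ℤ) + e) = -((k + 1 : ℕ) : ℤ) + e := by push_cast; ring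
      have e3 : e + ((k + 1 : ℕ) : ℤ) * -1 = -((k + 1 : ℕ) : ℤ) + e := by ring
      rw [e2] at h2
      rw [e3] at h3
      rw [h1, map_add, map_mul, map_mul, map_pow]
      constructor
      · intro e' he'
        rw [HahnSeries.coeff_add, h2.1 e' he', h3.1 e' he', add_zero]
      · have e4 : circ n R ((k + 1 : ℕ) : ℤ) = circ n R 1 * circ n R k := by
          rw [circ_mul hn0, Nat.cast_succ, add_comm]
        rw [HahnSeries.coeff_add, h2.2, h3.2, (coeff_pow_of_low l₂ (k + 1)).2, c₁, c₂, ih.2,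
          circ_pow hn0, mul_one, Matrix.mul_smul, ← Matrix.mul_assoc, hcomm, Matrix.mul_assoc,
          ← e4]
        push_cast
        module
  have h1 := (hpow (n - 1)).2
  rw [Nat.sub_add_cancel hn0, h₁.pow_eq, h₂.pow_eq, sub_self, map_zero, HahnSeries.coeff_zero] at h1
  have h2 : D.coeff e * circ n R ((n - 1 : ℕ) : ℤ) = 0 := by
    have h3 := congrArg (fun X => (n : ℚ)⁻¹ • X) h1
    simp only [smul_zero, smul_smul] at h3
    rw [inv_mul_cancel₀ (by exact_mod_cast hn0.ne'), one_smul] at h3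
    exact h3.symm
  refine hDe ?_
  rw [← Matrix.mul_one (D.coeff e), ← circ_mul_neg hn0 ((n - 1 : ℕ) : ℤ), ← Matrix.mul_assoc, h2,
    Matrix.zero_mul]

end Root

/-! ### The matrix `Z` over a differential ring -/

section LaxMatrix

variable {n : ℕ} {R : Type*} [CommRing R] (δ : Derivation ℤ R R)

theorem mul_bMatR_add_apply {u : Matrix (Fin n) (Fin n) R} (hu : InVR u)
    (Z : Matrix (Fin n) (Fin n) R) (i : Fin n) {k : Fin n} (hk : (k : ℕ) + 1 < n) :
    (Z * (bMatR n R + u)) i k = Z i ⟨k + 1, hk⟩ := by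
  rw [Matrix.mul_apply, Finset.sum_eq_single ⟨k + 1, hk⟩]
  · rw [Matrix.add_apply, hu _ _ (by omega)]
    simp [bMatR]
  · intro l _ hl
    have : ¬ (l : ℕ) = k + 1 := fun h => hl (Fin.ext h)
    rw [Matrix.add_apply, hu _ _ (by omega)]
    simp [bMatR, this]
  · simp

/-- The columns `(∂ + b + u) ^ k v`. -/
noncomputable def krylovColumn (u : Matrix (Fin n) (Fin n) R) (v : Fin n → R) : ℕ → Fin n → R
  | 0 => v
  | k + 1 => fun i => δ (krylovColumn u v k i) + ((bMatR n R + u) *ᵥ krylovColumn u v k) i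

/-- Let `A' + [b + u, A] + [e_{1n}, B] = 0`. The matrix `Z` with columns `(∂ + b + u) ^ k A e₁`
differs from `A` by a strictly upper triangular matrix, and `Z' + [b + u, Z]` is concentrated in
the last column above the last entry; that entry is the derivative of the trace of `A`,
which vanishes. -/
theorem exists_sub_strictUpper (hn : 0 < n) {u A B : Matrix (Fin n) (Fin n) R} (hu : InVR u)
    (h : A.map δ + ((bMatR n R + u) * A - A * (bMatR n R + u)) +
      (cornerMatR n R * B - B * cornerMatR n R) = 0) :
    ∃ Z : Matrix (Fin n) (Fin n) R, (∀ i k, k ≤ i → A i k = Z i k) ∧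
      InVR (Z.map δ + ((bMatR n R + u) * Z - Z * (bMatR n R + u))) := by
  set v : Fin n → R := fun i => A i ⟨0, hn⟩ with hv
  set Z : Matrix (Fin n) (Fin n) R := Matrix.of fun i k => krylovColumn δ u v k i with hZ
  have hcol : ∀ i k : Fin n, (k : ℕ) + 1 < n →
      (Z.map δ + ((bMatR n R + u) * Z - Z * (bMatR n R + u))) i k = 0 := fun i k hk => by
    rw [Matrix.add_apply, Matrix.sub_apply, mul_bMatR_add_apply hu Z i hk]
    simp only [hZ, of_apply, map_apply, krylovColumn, Matrix.mul_apply, mulVec, dotProduct]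
    ring
  -- `[e_{1n}, B]` lives in the first row and the last column, so that below the first row both
  -- matrices obey the same recursion from column to column
  have hAZ : ∀ m : ℕ, ∀ hm : m < n, ∀ i : Fin n, m ≤ i → A i ⟨m, hm⟩ = Z i ⟨m, hm⟩ := by
    intro m
    induction m with
    | zero => intro hm i _; simp [hZ, krylovColumn, hv]
    | succ m ih =>
      intro hm i hi
      have hmn : m < n := by omega
      have h1 := congrFun (congrFun h i) ⟨m, hmn⟩
      have h2 := hcol i ⟨m, hmn⟩ hm
      rw [Matrix.add_apply, Matrix.sub_apply, mul_bMatR_add_apply hu _ i hm] at h2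
      rw [Matrix.add_apply, Matrix.add_apply, Matrix.sub_apply, Matrix.sub_apply,
        mul_bMatR_add_apply hu _ i hm] at h1
      have h3 : (cornerMatR n R * B) i ⟨m, hmn⟩ = 0 := by
        rw [Matrix.mul_apply]
        refine Finset.sum_eq_zero fun l _ => ?_
        rw [cornerMatR, of_apply, if_neg (by omega), zero_mul]
      have h4 : (B * cornerMatR n R) i ⟨m, hmn⟩ = 0 := by
        rw [Matrix.mul_apply]
        refine Finset.sum_eq_zero fun l _ => ?_
        rw [cornerMatR, of_apply, if_neg (by simp only; omega), mul_zero]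
      have h5 : ((bMatR n R + u) * A) i ⟨m, hmn⟩ = ((bMatR n R + u) * Z) i ⟨m, hmn⟩ := by
        rw [Matrix.mul_apply, Matrix.mul_apply]
        refine Finset.sum_congr rfl fun l _ => ?_
        rcases le_or_gt m l with hl | hl
        · rw [ih hmn l hl]
        · have hb : bMatR n R i l = 0 := by
            rw [bMatR, of_apply, if_neg (by omega)]
          rw [Matrix.add_apply, hb, hu i l (by omega), zero_add, zero_mul, zero_mul]
      rw [h3, h4, h5, map_apply, ih hmn i (by omega)] at h1
      rw [map_apply] at h2
      rw [Matrix.zero_apply] at h1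
      linear_combination h2 - h1
  have hAZ' : ∀ i k : Fin n, k ≤ i → A i k = Z i k := fun i k hik => hAZ k k.2 i hik
  refine ⟨Z, hAZ', fun i k hik => ?_⟩
  by_cases hk : (k : ℕ) + 1 < n
  · exact hcol i k hk
  have hk' : (k : ℕ) + 1 = n := by have := k.2; omega
  have hi : i = k := by
    have := i.2
    ext
    omega
  subst hi
  -- only the last diagonal entry remains, and it equals the trace
  have htr := congrArg Matrix.trace h
  have hmap : ∀ X : Matrix (Fin n) (Fin n) R, (X.map δ).trace = δ X.trace := fun X => by
    simp [Matrix.trace]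
  rw [trace_add, trace_add, trace_sub, trace_sub, Matrix.trace_mul_comm _ A,
    Matrix.trace_mul_comm _ B, sub_self, sub_self, hmap, trace_zero, add_zero, add_zero] at htr
  have hAZtr : A.trace = Z.trace := Finset.sum_congr rfl fun l _ => hAZ' l l le_rfl
  have h1 : (Z.map δ + ((bMatR n R + u) * Z - Z * (bMatR n R + u))).trace = 0 := by
    rw [trace_add, trace_sub, Matrix.trace_mul_comm _ Z, sub_self, hmap, ← hAZtr, htr, add_zero]
  rw [Matrix.trace, Finset.sum_eq_single i] at h1
  · exact h1
  · intro l _ hl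
    refine hcol l l ?_
    have h2 := l.2
    have h3 : (l : ℕ) ≠ i := fun h => hl (Fin.ext h)
    omega
  · simp

end LaxMatrix

/-! ### Smooth functions as a differential ring -/

section SmoothFunctions

/-- The algebra of smooth functions of `(x, t)`, as a subalgebra of all functions. -/
def smoothSubalgebra : Subalgebra ℝ (ℝ × ℝ → ℝ) where
  carrier := {f | ContDiff ℝ ∞ f}
  mul_mem' {f g} hf hg := by
    rw [Set.mem_ofPred_eq] at *
    exact hf.mul hg
  add_mem' {f g} hf hg := by
    rw [Set.mem_ofPred_eq] at *
    exact hf.add hg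
  algebraMap_mem' c := by
    rw [Set.mem_ofPred_eq]
    exact contDiff_const

/-- The ring of smooth functions of `(x, t)`. -/
def SmoothFn : Type := smoothSubalgebra

noncomputable instance : CommRing SmoothFn := inferInstanceAs (CommRing smoothSubalgebra)

noncomputable instance : Algebra ℚ SmoothFn := inferInstanceAs (Algebra ℚ smoothSubalgebra)

namespace SmoothFn

/-- A smooth function, as an element of the ring `SmoothFn`. -/
def ofFun (f : ℝ × ℝ → ℝ) (hf : ContDiff ℝ ∞ f) : SmoothFn := ⟨f, hf⟩

/-- The value of a smooth function at a point. -/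
noncomputable def eval (p : ℝ × ℝ) : SmoothFn →+* ℝ :=
  (Pi.evalRingHom (fun _ : ℝ × ℝ => ℝ) p).comp smoothSubalgebra.val.toRingHom

theorem eval_ofFun (f : ℝ × ℝ → ℝ) (hf : ContDiff ℝ ∞ f) (p : ℝ × ℝ) : eval p (ofFun f hf) = f p :=
  rfl

@[ext]
theorem ext {f g : SmoothFn} (h : ∀ p, eval p f = eval p g) : f = g :=
  Subtype.ext (funext h)

theorem contDiff (f : SmoothFn) : ContDiff ℝ ∞ fun p => eval p f := f.2

theorem hasFDerivAt (f : SmoothFn) (p : ℝ × ℝ) :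
    HasFDerivAt (fun p => eval p f) (fderiv ℝ (fun p => eval p f) p) p :=
  (f.contDiff.differentiable (by simp) p).hasFDerivAt

instance : IsReduced SmoothFn where
  eq_zero f hf := by
    obtain ⟨k, hk⟩ := hf
    ext p
    have := congrArg (eval p) hk
    rw [map_pow, map_zero] at this
    rw [map_zero, eq_zero_of_pow_eq_zero this]

/-- The derivation `∂_x` of the ring of smooth functions of `(x, t)`. -/
noncomputable def derivX : Derivation ℤ SmoothFn SmoothFn :=
  Derivation.mk' (AddMonoidHom.toIntLinearMap
    { toFun f := ofFun (fun p => fderiv ℝ (fun p => eval p f) p (1, 0))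
        ((f.contDiff.fderiv_right (m := ∞) (by simp)).clm_apply contDiff_const)
      map_zero' := by
        ext p
        simp [eval_ofFun]
      map_add' f g := by
        ext p
        have := ((f.hasFDerivAt p).fun_add (g.hasFDerivAt p)).fderiv
        simp only [map_add, eval_ofFun]
        rw [this]
        rfl }) fun f g => by
    ext p
    have := ((f.hasFDerivAt p).fun_mul (g.hasFDerivAt p)).fderiv
    change fderiv ℝ (fun p => eval p f * eval p g) p (1, 0) =
      eval p f * fderiv ℝ (fun p => eval p g) p (1, 0) +
        eval p g * fderiv ℝ (fun p => eval p f) p (1, 0)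
    rw [this]
    rfl

theorem hasDerivAt_derivX (f : SmoothFn) (x t : ℝ) :
    HasDerivAt (fun y => eval (y, t) f) (eval (x, t) (derivX f)) x := by
  have h : HasDerivAt (fun y : ℝ => (y, t)) (1, 0) x :=
    (hasDerivAt_id x).prodMk (hasDerivAt_const x t)
  exact (f.hasFDerivAt (x, t)).comp_hasDerivAt x h

end SmoothFn

open SmoothFn

variable {n : ℕ}

/-- Evaluation of a matrix of smooth functions at a point. -/
noncomputable def evalMat (n : ℕ) (p : ℝ × ℝ) :
    Matrix (Fin n) (Fin n) SmoothFn →+* Matrix (Fin n) (Fin n) ℝ :=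
  (eval p).mapMatrix

/-- Coefficientwise evaluation of a series with smooth coefficients at a point. -/
noncomputable def evalLoop (n : ℕ) (p : ℝ × ℝ) :
    LaurentSeries (Matrix (Fin n) (Fin n) SmoothFn) →+* Loop n where
  toFun X := X.map (evalMat n p : Matrix (Fin n) (Fin n) SmoothFn →ₙ+* Matrix (Fin n) (Fin n) ℝ)
  map_zero' := by ext; simp
  map_one' := by
    ext1
    funext e
    simp only [HahnSeries.map_coeff, HahnSeries.coeff_one]
    split_ifs
    · exact map_one (evalMat n p)
    · exact map_zero (evalMat n p)
  map_add' X Y := by ext; simp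
  map_mul' X Y := HahnSeries.map_mul _

theorem evalMat_apply (p : ℝ × ℝ) (A : Matrix (Fin n) (Fin n) SmoothFn) (i k : Fin n) :
    evalMat n p A i k = eval p (A i k) := rfl

theorem coeff_evalLoop (p : ℝ × ℝ) (X : LaurentSeries (Matrix (Fin n) (Fin n) SmoothFn)) (e : ℤ) :
    (evalLoop n p X).coeff e = evalMat n p (X.coeff e) := rfl

theorem evalMat_ext {A B : Matrix (Fin n) (Fin n) SmoothFn}
    (h : ∀ p, evalMat n p A = evalMat n p B) : A = B := by
  ext i k p
  exact congrFun (congrFun (h p) i) k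

theorem evalMat_bMatR (p : ℝ × ℝ) : evalMat n p (bMatR n SmoothFn) = bMat n := by
  ext i k
  rw [evalMat_apply, bMatR, bMat, of_apply, of_apply]
  split_ifs <;> simp

theorem evalMat_cornerMatR (p : ℝ × ℝ) : evalMat n p (cornerMatR n SmoothFn) = cornerMat n := by
  ext i k
  rw [evalMat_apply, cornerMatR, cornerMat, of_apply, of_apply]
  split_ifs <;> simp

theorem evalLoop_single (p : ℝ × ℝ) (e : ℤ) (A : Matrix (Fin n) (Fin n) SmoothFn) :
    evalLoop n p (HahnSeries.single e A) = HahnSeries.single e (evalMat n p A) := by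
  ext1
  funext m
  rw [coeff_evalLoop, HahnSeries.coeff_single, HahnSeries.coeff_single]
  split_ifs <;> simp

theorem evalLoop_laxMat (p : ℝ × ℝ) (u : Matrix (Fin n) (Fin n) SmoothFn) :
    evalLoop n p (laxMat u) = JMat n + monomial (evalMat n p u) 0 := by
  rw [laxMat, map_add, evalLoop_single, evalLoop_single, evalMat_cornerMatR, map_add,
    evalMat_bMatR, HahnSeries.single_add, JMat, monomial, monomial, monomial, neg_zero, add_assoc]

theorem matDeriv_evalMat (A : Matrix (Fin n) (Fin n) SmoothFn) (x t : ℝ) :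
    matDeriv n (fun y => evalMat n (y, t) A) x = evalMat n (x, t) (A.map derivX) := by
  ext i k
  exact (hasDerivAt_derivX (A i k) x t).deriv

theorem bracket_evalMat (u Z : Matrix (Fin n) (Fin n) SmoothFn) (x t : ℝ) :
    bracket n (fun y => evalMat n (y, t) u) (fun y => evalMat n (y, t) Z) x =
      evalMat n (x, t)
        (Z.map derivX + ((bMatR n SmoothFn + u) * Z - Z * (bMatR n SmoothFn + u))) := by
  rw [bracket, matDeriv_evalMat]
  simp only [map_add, map_sub, map_mul, evalMat_bMatR]

theorem matSmooth_evalMat (A : Matrix (Fin n) (Fin n) SmoothFn) (t : ℝ) :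
    MatSmooth n fun x => evalMat n (x, t) A := fun i k =>
  (A i k).contDiff.comp (contDiff_id.prodMk contDiff_const)

end SmoothFunctions

/-! ### The series `Y(u, λ)` -/

section SeriesY

open SmoothFn

variable {n : ℕ}

theorem IsLaxRoot.isY {u : Matrix (Fin n) (Fin n) SmoothFn}
    {Y : LaurentSeries (Matrix (Fin n) (Fin n) SmoothFn)} (hY : IsLaxRoot derivX u Y)
    (htr : ∀ k, (Y.coeff k).trace = 0) (t : ℝ) :
    IsY n (fun x => evalMat n (x, t) u) fun x => evalLoop n (x, t) Y where
  smooth k := matSmooth_evalMat _ t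
  trace_zero k x := by
    have := congrArg (eval (x, t)) (htr (-k))
    simpa [lamCoeff, coeff_evalLoop, Matrix.trace, evalMat_apply] using this
  leading x := by
    rw [lamCoeff, coeff_evalLoop, hY.leading, evalMat_cornerMatR]
  bounded k hk x := by
    rw [lamCoeff, coeff_evalLoop, hY.bounded _ (by omega), map_zero]
  commutes k x := by
    have h := congrArg (evalMat n (x, t)) (hY.commutes (-k))
    rw [map_add, ← coeff_evalLoop, map_sub, map_mul, map_mul, evalLoop_laxMat, map_zero,
      ← matDeriv_evalMat] at h
    exact h
  pow_eq x := by
    rw [← map_pow, hY.pow_eq, evalLoop_single, map_one]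
    rfl

/-- A solution `Y` of the defining equations, for `u` smooth in `x`, comes from a root over the
ring of smooth functions of `(x, t)`, constant in `t`. -/
theorem IsY.exists_isLaxRoot {u : Matrix (Fin n) (Fin n) SmoothFn} {t₀ : ℝ}
    (hu : ∀ x t, evalMat n (x, t) u = evalMat n (x, t₀) u) {Y : ℝ → Loop n}
    (hY : IsY n (fun x => evalMat n (x, t₀) u) Y) :
    ∃ Y' : LaurentSeries (Matrix (Fin n) (Fin n) SmoothFn), IsLaxRoot derivX u Y' ∧
      ∀ x t, evalLoop n (x, t) Y' = Y x := by
  let Y' : LaurentSeries (Matrix (Fin n) (Fin n) SmoothFn) := HahnSeries.ofSuppBddBelow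
    (fun e => Matrix.of fun i k => ofFun (fun p => (Y p.1).coeff e i k) (by
      have := (hY.smooth (-e) i k).comp (contDiff_fst (𝕜 := ℝ) (E := ℝ) (F := ℝ))
      simp only [lamCoeff, neg_neg] at this
      exact this)) ⟨-1, fun e he => by
      by_contra hlt
      refine he ?_
      ext i k p
      have := hY.bounded (-e) (by omega) p.1
      rw [lamCoeff, neg_neg] at this
      change (Y p.1).coeff e i k = eval p 0
      rw [this, Matrix.zero_apply, map_zero]⟩
  have hev : ∀ x t, evalLoop n (x, t) Y' = Y x := fun x t => by
    ext e i k
    rfl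
  refine ⟨Y', ⟨?_, ?_, ?_, ?_⟩, hev⟩
  · refine evalMat_ext fun p => ?_
    rw [← coeff_evalLoop, hev, evalMat_cornerMatR]
    exact hY.leading p.1
  · intro k hk
    refine evalMat_ext fun p => ?_
    rw [← coeff_evalLoop, hev, map_zero]
    have := hY.bounded (-k) (by omega) p.1
    rwa [lamCoeff, neg_neg] at this
  · intro k
    refine evalMat_ext fun p => ?_
    have h := hY.commutes (-k) p.1
    simp only [lamCoeff, neg_neg] at h
    rw [map_add, ← coeff_evalLoop, map_sub, map_mul, map_mul, evalLoop_laxMat, map_zero, hev,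
      ← matDeriv_evalMat, hu]
    simp only [← coeff_evalLoop, hev]
    exact h
  · ext1
    funext e
    refine evalMat_ext fun p => ?_
    rw [← coeff_evalLoop, ← coeff_evalLoop, map_pow, hev, hY.pow_eq, evalLoop_single, map_one]
    rfl

/-- The matrix-valued function `u`, smooth in `(x, t)`, as a matrix over the ring of smooth
functions. -/
def toSmoothFn (u : ℝ → ℝ → Matrix (Fin n) (Fin n) ℝ)
    (hu : ∀ i k : Fin n, ContDiff ℝ ∞ fun p : ℝ × ℝ => u p.1 p.2 i k) :
    Matrix (Fin n) (Fin n) SmoothFn :=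
  Matrix.of fun i k => ofFun (fun p => u p.1 p.2 i k) (hu i k)

theorem evalMat_toSmoothFn (u : ℝ → ℝ → Matrix (Fin n) (Fin n) ℝ)
    (hu : ∀ i k : Fin n, ContDiff ℝ ∞ fun p : ℝ × ℝ => u p.1 p.2 i k) (x t : ℝ) :
    evalMat n (x, t) (toSmoothFn u hu) = u x t := rfl

theorem inVR_toSmoothFn {u : ℝ → ℝ → Matrix (Fin n) (Fin n) ℝ}
    (hu : ∀ i k : Fin n, ContDiff ℝ ∞ fun p : ℝ × ℝ => u p.1 p.2 i k)
    (hV : ∀ x t, InV n (u x t)) : InVR (toSmoothFn u hu) := fun i k h => by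
  ext p
  rw [toSmoothFn, of_apply, eval_ofFun, hV p.1 p.2 i k h, map_zero]

theorem IsY.unique (hn : 2 ≤ n) {u : ℝ → Matrix (Fin n) (Fin n) ℝ} (hu : MatSmooth n u)
    (hV : ∀ x, InV n (u x)) {Y₁ Y₂ : ℝ → Loop n} (h₁ : IsY n u Y₁) (h₂ : IsY n u Y₂) : Y₁ = Y₂ := by
  have hu' : ∀ i k : Fin n,
      ContDiff ℝ ∞ fun p : ℝ × ℝ => (fun x _ => u x : ℝ → ℝ → _) p.1 p.2 i k :=
    fun i k => (hu i k).comp contDiff_fst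
  have key : ∀ Y, IsY n u Y →
      IsY n (fun x => evalMat n (x, 0) (toSmoothFn (fun x _ => u x) hu')) Y :=
    fun _ h => h
  obtain ⟨Y₁', r₁, e₁⟩ := IsY.exists_isLaxRoot (fun _ _ => rfl) (key _ h₁)
  obtain ⟨Y₂', r₂, e₂⟩ := IsY.exists_isLaxRoot (fun _ _ => rfl) (key _ h₂)
  have h := r₁.unique hn (inVR_toSmoothFn hu' fun x _ => hV x) r₂
  funext x
  rw [← e₁ x 0, h, e₂]

/-- The zeroth coefficients `Y_{j,0}` for a family `u(·, t)`: they are the values of a matrix of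
smooth functions of `(x, t)` that satisfies the `λ⁰` part of the Lax equation. -/
theorem exists_Yj0_eq (hn : 2 ≤ n) {j : ℕ} (hj : ¬ n ∣ j)
    {u : ℝ → ℝ → Matrix (Fin n) (Fin n) ℝ}
    (hu : ∀ i k : Fin n, ContDiff ℝ ∞ fun p : ℝ × ℝ => u p.1 p.2 i k)
    (hV : ∀ x t, InV n (u x t)) :
    ∃ A B : Matrix (Fin n) (Fin n) SmoothFn,
      (∀ x t, Yj0 n j (fun y => u y t) x = evalMat n (x, t) A) ∧ A.trace = 0 ∧
      A.map derivX + ((bMatR n SmoothFn + toSmoothFn u hu) * A -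
          A * (bMatR n SmoothFn + toSmoothFn u hu)) +
        (cornerMatR n SmoothFn * B - B * cornerMatR n SmoothFn) = 0 := by
  obtain ⟨Y, hY, hYj⟩ := exists_isLaxRoot derivX hn (inVR_toSmoothFn hu hV)
  have htr : ∀ k, (Y.coeff k).trace = 0 := by
    have h1 : ¬ n ∣ 1 := by
      intro h
      have := Nat.le_of_dvd one_pos h
      omega
    simpa using (hYj 1).2 h1
  refine ⟨(Y ^ j).coeff 0, (Y ^ j).coeff 1, fun x t => ?_, (hYj j).2 hj 0, ?_⟩
  · have hYt := hY.isY htr t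
    have hex : ∃ Y, IsY n (fun y => u y t) Y := ⟨_, hYt⟩
    have : seriesY n (fun y => u y t) = fun x => evalLoop n (x, t) Y := by
      rw [seriesY, dif_pos hex]
      exact hex.choose_spec.unique hn
        (fun i k => (hu i k).comp (contDiff_id.prodMk contDiff_const)) (fun x => hV x t) hYt
    rw [Yj0, this, lamCoeff, ← map_pow, neg_zero, coeff_evalLoop]
  · have h := (hYj j).1 0
    rw [laxMat, add_mul, mul_add, HahnSeries.coeff_sub, HahnSeries.coeff_add, HahnSeries.coeff_add,
      HahnSeries.coeff_single_mul, HahnSeries.coeff_single_mul, HahnSeries.coeff_mul_single,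
      HahnSeries.coeff_mul_single, sub_zero, zero_sub, neg_neg] at h
    rw [← h]
    abel

/-- If `[∂ + b + u, Z] ∈ V`, then `∂ + b + u` maps each column of `Z` to the next one. -/
theorem InV.col_eq {u : ℝ → Matrix (Fin n) (Fin n) ℝ} (hu : ∀ x, InV n (u x))
    {Z : ℝ → Matrix (Fin n) (Fin n) ℝ} {x : ℝ} (hZ : InV n (bracket n u Z x)) (i : Fin n)
    {k : Fin n} (hk : (k : ℕ) + 1 < n) :
    Z x i ⟨k + 1, hk⟩ = deriv (fun y => Z y i k) x + ((bMat n + u x) * Z x) i k := by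
  have h := hZ i k (by omega)
  have hb : bMat n = bMatR n ℝ := rfl
  rw [bracket, Matrix.add_apply, Matrix.sub_apply, hb, mul_bMatR_add_apply (hu x) _ i hk,
    ← hb] at h
  rw [matDeriv, of_apply] at h
  linarith

/-- A matrix `Z` with `[∂ + b + u, Z] ∈ V` is determined by its first column. -/
theorem eq_of_bracket_mem {u : ℝ → Matrix (Fin n) (Fin n) ℝ} (hu : ∀ x, InV n (u x))
    {Z₁ Z₂ : ℝ → Matrix (Fin n) (Fin n) ℝ} (h₁ : ∀ x, InV n (bracket n u Z₁ x))
    (h₂ : ∀ x, InV n (bracket n u Z₂ x))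
    (h0 : ∀ x i (k : Fin n), (k : ℕ) = 0 → Z₁ x i k = Z₂ x i k) :
    Z₁ = Z₂ := by
  have : ∀ m : ℕ, ∀ hm : m < n, ∀ x i, Z₁ x i ⟨m, hm⟩ = Z₂ x i ⟨m, hm⟩ := by
    intro m
    induction m with
    | zero => exact fun hm x i => h0 x i _ rfl
    | succ m ih =>
      intro hm x i
      have hmn : m < n := by omega
      rw [InV.col_eq hu (h₁ x) i (k := ⟨m, hmn⟩) hm, InV.col_eq hu (h₂ x) i (k := ⟨m, hmn⟩) hm]
      congr 1
      · congr 1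
        funext y
        exact ih hmn y i
      · simp only [Matrix.mul_apply, ih hmn]
  funext x
  ext i k
  exact this k k.2 x i

/-- For `u` smooth in `(x, t)`, the matrix `Z_{j,0}` is smooth in `(x, t)` and traceless, and
`[∂ + b + u, Z_{j,0}] ∈ V`. -/
theorem Zj0_spec (hn : 2 ≤ n) {j : ℕ} (hj : ¬ n ∣ j) {u : ℝ → ℝ → Matrix (Fin n) (Fin n) ℝ}
    (hu : ∀ i k : Fin n, ContDiff ℝ ∞ fun p : ℝ × ℝ => u p.1 p.2 i k)
    (hV : ∀ x t, InV n (u x t)) :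
    (∀ i k, ContDiff ℝ ∞ fun p : ℝ × ℝ => Zj0 n j (fun y => u y p.2) p.1 i k) ∧
      (∀ x t, (Zj0 n j (fun y => u y t) x).trace = 0) ∧
      ∀ x t, InV n (bracket n (fun y => u y t) (Zj0 n j fun y => u y t) x) := by
  obtain ⟨A, B, hA, hAtr, hAB⟩ := exists_Yj0_eq hn hj hu hV
  obtain ⟨Z, hAZ, hZ⟩ := exists_sub_strictUpper derivX (by omega) (inVR_toSmoothFn hu hV) hAB
  have hbr : ∀ x t, InV n (bracket n (fun y => u y t) (fun y => evalMat n (y, t) Z) x) :=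
    fun x t => by
      have := bracket_evalMat (toSmoothFn u hu) Z x t
      simp only [evalMat_toSmoothFn] at this
      rw [this]
      intro i k h
      rw [evalMat_apply, hZ i k h, map_zero]
  have key : ∀ t, Zj0 n j (fun y => u y t) = fun x => evalMat n (x, t) Z := fun t => by
    have hz : IsZeta n j (fun y => u y t) fun y => evalMat n (y, t) (A - Z) := by
      refine ⟨matSmooth_evalMat _ t, fun x i k hik => ?_, fun x => ?_⟩
      · rw [evalMat_apply, Matrix.sub_apply, hAZ i k hik, sub_self, map_zero]
      · simp only [hA, map_sub, sub_sub_cancel]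
        exact hbr x t
    have hex : ∃ ζ, IsZeta n j (fun y => u y t) ζ := ⟨_, hz⟩
    have hs := hex.choose_spec
    have hzeta : zeta n j (fun y => u y t) = hex.choose := by rw [zeta, dif_pos hex]
    refine eq_of_bracket_mem (u := fun y => u y t) (fun x => hV x t) ?_ (fun x => hbr x t) ?_
    · unfold Zj0
      rw [hzeta]
      exact hs.bracket_mem
    · intro x i k hk
      rw [Zj0, hzeta, hA, Matrix.sub_apply, hs.strictUpper x i k (by rw [Fin.le_def]; omega),
        sub_zero, evalMat_apply, evalMat_apply, hAZ i k (by rw [Fin.le_def]; omega)]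
  refine ⟨fun i k => ?_, fun x t => ?_, fun x t => ?_⟩
  · simp only [key]
    exact (Z i k).contDiff
  · rw [key]
    have h1 : A.trace = Z.trace := Finset.sum_congr rfl fun l _ => hAZ l l le_rfl
    have h2 := congrArg (eval (x, t)) (h1.symm.trans hAtr)
    simpa [Matrix.trace, evalMat_apply] using h2
  · rw [key]
    exact hbr x t

end SeriesY

/-! ### Linear differential equations in a Banach algebra -/

section ODE

open Set Filter Topology

variable {𝔸 : Type*} [NormedRing 𝔸] [NormedAlgebra ℝ 𝔸]

/-- The terms of the Picard series of the equation `h_x = h A` with initial value `c(t)` at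
`x = 0`. -/
noncomputable def picardTerm (A : ℝ × ℝ → 𝔸) (c : ℝ → 𝔸) : ℕ → ℝ × ℝ → 𝔸
  | 0 => fun p => c p.2
  | k + 1 => fun p => ∫ s in (0 : ℝ)..p.1, picardTerm A c k (s, p.2) * A (s, p.2)

theorem continuous_picardTerm {A : ℝ × ℝ → 𝔸} {c : ℝ → 𝔸} (hA : Continuous A) (hc : Continuous c)
    (k : ℕ) : Continuous (picardTerm A c k) := by
  induction k with
  | zero => exact hc.comp continuous_snd
  | succ k ih =>
    refine intervalIntegral.continuous_parametric_intervalIntegral_of_continuous ?_ continuous_fst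
    have h : Continuous fun q : (ℝ × ℝ) × ℝ => (q.2, q.1.2) := by fun_prop
    exact (ih.comp h).mul (hA.comp h)

theorem norm_picardTerm_le {A : ℝ × ℝ → 𝔸} {c : ℝ → 𝔸} (hA : Continuous A) (hc : Continuous c)
    {X K C t : ℝ} (hK : ‖c t‖ ≤ K) (hC : ∀ s, |s| ≤ X → ‖A (s, t)‖ ≤ C) (k : ℕ) {x : ℝ}
    (hx : |x| ≤ X) : ‖picardTerm A c k (x, t)‖ ≤ K * C ^ k * |x| ^ k / k.factorial := by
  have hC0 : 0 ≤ C := (norm_nonneg _).trans (hC x hx)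
  induction k generalizing x with
  | zero => simpa [picardTerm] using hK
  | succ k ih =>
    have hsub : ∀ s ∈ uIoc 0 x, |s| ≤ |x| := fun s hs => by
      rcases le_total 0 x with h | h
      · rw [uIoc_of_le h] at hs
        rw [abs_of_pos hs.1, abs_of_nonneg h]
        exact hs.2
      · rw [uIoc_of_ge h] at hs
        rw [abs_of_nonpos hs.2, abs_of_nonpos h]
        linarith [hs.1]
    have hcont : Continuous fun s => picardTerm A c k (s, t) * A (s, t) :=
      ((continuous_picardTerm hA hc k).comp (by fun_prop)).mul (hA.comp (by fun_prop))
    calc ‖picardTerm A c (k + 1) (x, t)‖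
        ≤ ∫ s in uIoc 0 x, ‖picardTerm A c k (s, t) * A (s, t)‖ :=
          intervalIntegral.norm_integral_le_integral_norm_uIoc
      _ ≤ ∫ s in uIoc 0 x, K * C ^ (k + 1) / k.factorial * |s - 0| ^ k := by
          refine MeasureTheory.setIntegral_mono_on ?_ ?_ measurableSet_uIoc fun s hs => ?_
          · exact (hcont.norm.integrableOn_uIcc).mono_set uIoc_subset_uIcc
          · refine (Continuous.integrableOn_uIcc ?_).mono_set uIoc_subset_uIcc
            fun_prop
          · have hs1 := (hsub s hs).trans hx
            refine (norm_mul_le _ _).trans ?_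
            have h1 := ih hs1
            have h2 := hC s hs1
            calc _ ≤ K * C ^ k * |s| ^ k / k.factorial * C := by
                  exact mul_le_mul h1 h2 (norm_nonneg _) ((norm_nonneg _).trans h1)
              _ = _ := by rw [sub_zero, pow_succ]; ring
      _ = K * C ^ (k + 1) * |x| ^ (k + 1) / (k + 1).factorial := by
          rw [MeasureTheory.integral_const_mul, integral_pow_abs_sub_uIoc, sub_zero,
            Nat.factorial_succ]
          have : (k.factorial : ℝ) ≠ 0 := by positivity
          push_cast
          field_simp

/-- The initial value problem `h_x = h A`, `h(0, t) = c(t)`, with `A` and `c` continuous, has a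
global solution that is continuous in `(x, t)`: the sum of the Picard series. -/
theorem exists_linear_ode [CompleteSpace 𝔸] {A : ℝ × ℝ → 𝔸} {c : ℝ → 𝔸} (hA : Continuous A)
    (hc : Continuous c) :
    ∃ h : ℝ × ℝ → 𝔸, Continuous h ∧ (∀ t, h (0, t) = c t) ∧
      ∀ x t, HasDerivAt (fun y => h (y, t)) (h (x, t) * A (x, t)) x := by
  have hterm := continuous_picardTerm hA hc
  -- on a box, the terms are dominated by those of an exponential series
  have hbound : ∀ X : ℝ, 0 ≤ X → ∃ K C : ℝ, 0 ≤ K ∧ 0 ≤ C ∧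
      (∀ x t, |x| ≤ X → |t| ≤ X → ‖A (x, t)‖ ≤ C) ∧
      ∀ k x t, |x| ≤ X → |t| ≤ X → ‖picardTerm A c k (x, t)‖ ≤ K * ((C * X) ^ k / k.factorial) := by
    intro X hX
    obtain ⟨K, hK⟩ := (isCompact_Icc (a := -X) (b := X)).exists_bound_of_continuousOn
      hc.continuousOn
    obtain ⟨C, hC⟩ := ((isCompact_Icc (a := -X) (b := X)).prod
      (isCompact_Icc (a := -X) (b := X))).exists_bound_of_continuousOn hA.continuousOn
    have hC' : ∀ x t, |x| ≤ X → |t| ≤ X → ‖A (x, t)‖ ≤ C := fun x t hx ht =>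
      hC (x, t) ⟨abs_le.1 hx, abs_le.1 ht⟩
    have hK0 : 0 ≤ K := (norm_nonneg _).trans (hK 0 ⟨by linarith, hX⟩)
    have hC0 : 0 ≤ C := (norm_nonneg _).trans (hC' 0 0 (by simpa) (by simpa))
    refine ⟨K, C, hK0, hC0, hC', fun k x t hx ht => ?_⟩
    refine (norm_picardTerm_le hA hc (hK t (abs_le.1 ht)) (fun s hs => hC' s t hs ht) k hx).trans ?_
    rw [mul_pow, mul_div_assoc, mul_assoc, mul_div_assoc]
    gcongr
  have hsum : ∀ x t, Summable fun k => picardTerm A c k (x, t) := fun x t => by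
    obtain ⟨K, C, -, -, -, h⟩ := hbound (max |x| |t|) (le_max_of_le_left (abs_nonneg x))
    exact .of_norm_bounded ((Real.summable_pow_div_factorial _).mul_left K)
      fun k => h k x t (le_max_left _ _) (le_max_right _ _)
  refine ⟨fun p => ∑' k, picardTerm A c k p, ?_, fun t => ?_, fun x t => ?_⟩
  · rw [continuous_iff_continuousAt]
    intro p
    set X := max |p.1| |p.2| + 1 with hX
    have hX0 : 0 ≤ X := by positivity
    obtain ⟨K, C, -, -, -, h⟩ := hbound X hX0
    have hc' : ContinuousOn (fun p => ∑' k, picardTerm A c k p) (Icc (-X) X ×ˢ Icc (-X) X) :=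
      continuousOn_tsum (fun k => (hterm k).continuousOn)
        ((Real.summable_pow_div_factorial (C * X)).mul_left K)
        fun k q hq => h k q.1 q.2 (abs_le.2 hq.1) (abs_le.2 hq.2)
    refine hc'.continuousAt (prod_mem_nhds (Icc_mem_nhds ?_ ?_) (Icc_mem_nhds ?_ ?_)) <;>
    linarith [neg_abs_le p.1, neg_abs_le p.2, le_abs_self p.1, le_abs_self p.2,
      le_max_left |p.1| |p.2|, le_max_right |p.1| |p.2|]
  · change ∑' k, picardTerm A c k (0, t) = c t
    rw [tsum_eq_single 0]
    · rfl
    · intro k hk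
      obtain ⟨k, rfl⟩ := Nat.exists_eq_succ_of_ne_zero hk
      simp [picardTerm]
  · set X := max |x| |t| + 1 with hX
    have hX0 : 0 ≤ X := by positivity
    have hx : |x| < X := by linarith [le_max_left |x| |t|]
    have ht : |t| ≤ X := by linarith [le_max_right |x| |t|]
    obtain ⟨K, C, hK0, hC0, hAC, h⟩ := hbound X hX0
    let g' : ℕ → ℝ → 𝔸 := fun k y => Nat.casesOn k 0 fun k => picardTerm A c k (y, t) * A (y, t)
    let v : ℕ → ℝ := fun k => Nat.casesOn k 0 fun k => K * ((C * X) ^ k / k.factorial) * C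
    have hv : Summable v := by
      rw [← summable_nat_add_iff 1]
      exact ((Real.summable_pow_div_factorial (C * X)).mul_left K).mul_right C
    have hd := hasDerivAt_tsum_of_isPreconnected (g := fun k y => picardTerm A c k (y, t))
      (g' := g') (t := Ioo (-X) X) (y₀ := x) (y := x) hv isOpen_Ioo isPreconnected_Ioo
      (fun k y _ => by
        cases k with
        | zero => exact hasDerivAt_const y (c t)
        | succ k =>
          have hcont : Continuous fun s => picardTerm A c k (s, t) * A (s, t) :=
            ((hterm k).comp (by fun_prop)).mul (hA.comp (by fun_prop))
          exact (hcont.integral_hasStrictDerivAt 0 y).hasDerivAt)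
      (fun k y hy => by
        cases k with
        | zero => simp [g', v]
        | succ k =>
          have hy' : |y| ≤ X := (abs_lt.2 hy).le
          refine (norm_mul_le _ _).trans ?_
          exact mul_le_mul (h k y t hy' ht) (hAC y t hy' ht) (norm_nonneg _) (by positivity))
      (abs_lt.1 hx) (hsum x t) (abs_lt.1 hx)
    have hg' : Summable fun k => g' k x := by
      rw [← summable_nat_add_iff 1]
      exact (hsum x t).mul_right _
    have heq : ∑' k, g' k x = (∑' k, picardTerm A c k (x, t)) * A (x, t) := by
      rw [hg'.tsum_eq_zero_add, ← (hsum x t).tsum_mul_right]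
      exact zero_add _
    rw [heq] at hd
    exact hd

/-- Grönwall's inequality on both sides of the initial point. -/
theorem norm_le_gronwallBound_abs {E : Type*} [NormedAddCommGroup E] [NormedSpace ℝ E]
    {f f' : ℝ → E} {C η X : ℝ} (hf : ∀ s, HasDerivAt f (f' s) s)
    (hb : ∀ s, |s| ≤ X → ‖f' s‖ ≤ C * ‖f s‖ + η) {x : ℝ} (hx : |x| ≤ X) :
    ‖f x‖ ≤ gronwallBound ‖f 0‖ C η |x| := by
  have key : ∀ (g g' : ℝ → E), (∀ s, HasDerivAt g (g' s) s) →
      (∀ s, |s| ≤ X → ‖g' s‖ ≤ C * ‖g s‖ + η) → ∀ y, 0 ≤ y → y ≤ X →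
      ‖g y‖ ≤ gronwallBound ‖g 0‖ C η y := by
    intro g g' hg hb y hy hyX
    have := norm_le_gronwallBound_of_norm_deriv_right_le (f := g) (f' := g') (δ := ‖g 0‖) (K := C)
      (ε := η) (a := 0) (b := y) (fun s _ => (hg s).continuousAt.continuousWithinAt)
      (fun s _ => (hg s).hasDerivWithinAt) le_rfl
      (fun s hs => hb s (by rw [abs_of_nonneg hs.1]; linarith [hs.2])) y (right_mem_Icc.2 hy)
    simpa using this
  rcases le_total 0 x with h | h
  · rw [abs_of_nonneg h] at hx ⊢
    exact key f f' hf hb x h hx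
  · rw [abs_of_nonpos h] at hx ⊢
    have := key (fun s => f (-s)) (fun s => -f' (-s))
      (fun s => by simpa [Function.comp_def] using (hf (-s)).scomp s (hasDerivAt_neg s))
      (fun s hs => by simpa using hb (-s) (by simpa using hs)) (-x) (by linarith) hx
    simpa using this

/-- If `h_x = h A` and `A_t = Z_x + [A, Z]`, then `h_t = h Z` holds for all `x` once it holds at
`x = 0`: the remainder `h(x, t + ε) - h(x, t) (1 + ε Z(x, t))` satisfies a linear equation whose
inhomogeneity is `o(ε)`. -/
theorem hasDerivAt_parameter {A Z h : ℝ × ℝ → 𝔸} (hA : ContDiff ℝ ∞ A) (hZ : ContDiff ℝ ∞ Z)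
    (hflat : ∀ p, fderiv ℝ A p (0, 1) = fderiv ℝ Z p (1, 0) + (A p * Z p - Z p * A p))
    (hh : Continuous h) (hx : ∀ x t, HasDerivAt (fun y => h (y, t)) (h (x, t) * A (x, t)) x)
    {t : ℝ} (h0 : HasDerivAt (fun s => h (0, s)) (h (0, t) * Z (0, t)) t) (x : ℝ) :
    HasDerivAt (fun s => h (x, s)) (h (x, t) * Z (x, t)) t := by
  have hAd : ∀ s τ, HasDerivAt (fun y => A (s, y)) (fderiv ℝ A (s, τ) (0, 1)) τ := fun s τ =>
    (hA.differentiable (by simp) (s, τ)).hasFDerivAt.comp_hasDerivAt τ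
      ((hasDerivAt_const τ s).prodMk (hasDerivAt_id τ))
  have hZd : ∀ s, HasDerivAt (fun y => Z (y, t)) (fderiv ℝ Z (s, t) (1, 0)) s := fun s =>
    (hZ.differentiable (by simp) (s, t)).hasFDerivAt.comp_hasDerivAt s
      ((hasDerivAt_id s).prodMk (hasDerivAt_const s t))
  have hAt : Continuous fun p => fderiv ℝ A p (0, 1) :=
    (hA.continuous_fderiv (by simp)).clm_apply continuous_const
  have hZx : Continuous fun p => fderiv ℝ Z p (1, 0) :=
    (hZ.continuous_fderiv (by simp)).clm_apply continuous_const
  have hAc := hA.continuous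
  have hZc := hZ.continuous
  set ρ : ℝ → ℝ → 𝔸 := fun s ε => A (s, t + ε) - A (s, t) +
    ε • (Z (s, t) * A (s, t + ε) - A (s, t) * Z (s, t) - fderiv ℝ Z (s, t) (1, 0)) with hρ
  set G : ℝ → ℝ → 𝔸 := fun ε s => fderiv ℝ A (s, t + ε) (0, 1) +
    ((Z (s, t) * A (s, t + ε) - A (s, t) * Z (s, t) - fderiv ℝ Z (s, t) (1, 0)) +
      ε • (Z (s, t) * fderiv ℝ A (s, t + ε) (0, 1))) with hG
  have hρd : ∀ s ε, HasDerivAt (ρ s) (G ε s) ε := fun s ε => by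
    have h1 : HasDerivAt (fun ε => A (s, t + ε)) (fderiv ℝ A (s, t + ε) (0, 1)) ε := by
      simpa [Function.comp_def] using (hAd s (t + ε)).comp_const_add t ε
    have h2 := (h1.sub_const (A (s, t))).add ((hasDerivAt_id ε).smul
      (((h1.const_mul (Z (s, t))).sub_const (A (s, t) * Z (s, t))).sub_const
        (fderiv ℝ Z (s, t) (1, 0))))
    refine h2.congr_deriv ?_
    simp only [hG, id_eq, one_smul]
    abel
  have hGc : Continuous fun p : ℝ × ℝ => G p.1 p.2 := by
    have e1 : Continuous fun p : ℝ × ℝ => (p.2, t + p.1) := by fun_prop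
    have e2 : Continuous fun p : ℝ × ℝ => (p.2, t) := by fun_prop
    exact (hAt.comp e1).add (((((hZc.comp e2).mul (hAc.comp e1)).sub
      ((hAc.comp e2).mul (hZc.comp e2))).sub (hZx.comp e2)).add
      (continuous_fst.smul ((hZc.comp e2).mul (hAt.comp e1))))
  have hG0 : ∀ s, G 0 s = 0 := fun s => by
    simp only [hG, add_zero, zero_smul, hflat]
    abel
  have hρ0 : ∀ s, ρ s 0 = 0 := fun s => by simp [hρ]
  set X := |x|
  -- the inhomogeneity is `o(ε)`, uniformly on compact sets
  have hρo : ∀ η > 0, ∀ᶠ ε in 𝓝 (0 : ℝ), ∀ s ∈ Icc (-X) X, ‖ρ s ε‖ ≤ η * |ε| := by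
    intro η hη
    have h1 : ∀ᶠ ε in 𝓝 (0 : ℝ), ∀ s ∈ Icc (-X) X, ‖G ε s‖ < η := by
      refine isCompact_Icc.eventually_forall_of_forall_eventually fun s _ => ?_
      refine hGc.norm.continuousAt.eventually (gt_mem_nhds ?_)
      simpa [hG0] using hη
    obtain ⟨δ, hδ, h2⟩ := Metric.eventually_nhds_iff_ball.1 h1
    refine Metric.eventually_nhds_iff_ball.2 ⟨δ, hδ, fun ε hε s hs => ?_⟩
    have := Convex.norm_image_sub_le_of_norm_hasDerivWithin_le (f := ρ s) (f' := fun ε => G ε s)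
      (s := Metric.ball 0 δ) (x := 0) (y := ε) (C := η)
      (fun y _ => (hρd s y).hasDerivWithinAt) (fun y hy => (h2 y hy s hs).le) (convex_ball 0 δ)
      (Metric.mem_ball_self hδ) hε
    simpa [hρ0] using this
  obtain ⟨C, hC⟩ := (isCompact_Icc (a := -X) (b := X)).prod
    (isCompact_Icc (a := t - 1) (b := t + 1)) |>.exists_bound_of_continuousOn hAc.continuousOn
  obtain ⟨H, hH⟩ := (isCompact_Icc (a := -X) (b := X)).exists_bound_of_continuousOn
    (f := fun s => h (s, t)) (hh.comp (by fun_prop)).continuousOn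
  have hX : (0 : ℝ) ∈ Icc (-X) X := by simp [X]
  have hH0 : 0 ≤ H := (norm_nonneg _).trans (hH 0 hX)
  set C' := max C 1 with hC'
  have hC'1 : 1 ≤ C' := le_max_right _ _
  rw [hasDerivAt_iff_isLittleO_nhds_zero] at h0 ⊢
  rw [Asymptotics.isLittleO_iff] at h0 ⊢
  intro κ hκ
  set E := Real.exp (C' * X)
  have hE : 0 < E := Real.exp_pos _
  have hη : 0 < κ / (2 * ((H + 1) * E)) := by positivity
  filter_upwards [h0 (show 0 < κ / (2 * E) by positivity), hρo _ hη,
    Metric.ball_mem_nhds (0 : ℝ) one_pos] with ε hε1 hε2 hε3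
  set f : ℝ → 𝔸 := fun s => h (s, t + ε) - h (s, t) * (1 + ε • Z (s, t)) with hf
  have hfd : ∀ s, HasDerivAt f (f s * A (s, t + ε) + h (s, t) * ρ s ε) s := fun s => by
    have := (hx s (t + ε)).sub ((hx s t).mul (((hZd s).const_smul ε).const_add 1))
    refine this.congr_deriv ?_
    simp only [hf, hρ, Pi.smul_apply, mul_add, mul_sub, sub_mul, mul_one, add_mul, mul_smul_comm,
      smul_mul_assoc, mul_assoc, smul_sub]
    abel
  have hfb : ∀ s, |s| ≤ X → ‖f s * A (s, t + ε) + h (s, t) * ρ s ε‖ ≤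
      C' * ‖f s‖ + H * (κ / (2 * ((H + 1) * E)) * |ε|) := fun s hs => by
    have hs' : s ∈ Icc (-X) X := abs_le.1 hs
    have hε3' : |ε| < 1 := by simpa using hε3
    have h1 : ‖A (s, t + ε)‖ ≤ C' := (hC (s, t + ε) ⟨hs', by
      constructor <;> linarith [neg_abs_le ε, le_abs_self ε]⟩).trans (le_max_left _ _)
    refine (norm_add_le _ _).trans (add_le_add ?_ ?_)
    · rw [mul_comm C']
      exact (norm_mul_le _ _).trans (mul_le_mul_of_nonneg_left h1 (norm_nonneg _))
    · exact (norm_mul_le _ _).trans (mul_le_mul (hH s hs') (hε2 s hs') (norm_nonneg _) hH0)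
  have hgr := norm_le_gronwallBound_abs hfd hfb (x := x) le_rfl
  have hexp : ∀ y τ, h (y, t + τ) - h (y, t) - τ • (h (y, t) * Z (y, t)) =
      h (y, t + τ) - h (y, t) * (1 + τ • Z (y, t)) := fun y τ => by
    rw [mul_add, mul_one, mul_smul_comm]
    abel
  rw [hexp] at hε1 ⊢
  rw [gronwallBound_of_K_ne_0 (by positivity)] at hgr
  refine hgr.trans ?_
  rw [Real.norm_eq_abs] at hε1 ⊢
  have hE1 : 1 ≤ E := Real.one_le_exp (by positivity)
  have h1 : H * (κ / (2 * ((H + 1) * E)) * |ε|) / C' * (E - 1) ≤ κ / 2 * |ε| := by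
    have h2 : H * (κ / (2 * ((H + 1) * E)) * |ε|) / C' ≤ H * (κ / (2 * ((H + 1) * E)) * |ε|) :=
      div_le_self (by positivity) hC'1
    calc _ ≤ H * (κ / (2 * ((H + 1) * E)) * |ε|) * E := by
          refine mul_le_mul h2 (by linarith) (by linarith) (by positivity)
      _ = H / (H + 1) * (κ / 2 * |ε|) := by field_simp
      _ ≤ 1 * (κ / 2 * |ε|) := by
          refine mul_le_mul_of_nonneg_right ?_ (by positivity)
          rw [div_le_one (by positivity)]
          linarith
      _ = _ := one_mul _
  have h2 : ‖f 0‖ * E ≤ κ / 2 * |ε| := by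
    calc _ ≤ κ / (2 * E) * |ε| * E := mul_le_mul_of_nonneg_right hε1 hE.le
      _ = _ := by field_simp
  calc _ ≤ κ / 2 * |ε| + κ / 2 * |ε| := add_le_add h2 h1
    _ = _ := by ring

/-- A continuous solution of `g_x = g A`, `g_t = g Z` with smooth `A`, `Z` is smooth. -/
theorem contDiff_of_partial {A Z g : ℝ × ℝ → 𝔸} (hA : ContDiff ℝ ∞ A) (hZ : ContDiff ℝ ∞ Z)
    (hg : Continuous g) (hx : ∀ x t, HasDerivAt (fun y => g (y, t)) (g (x, t) * A (x, t)) x)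
    (ht : ∀ x t, HasDerivAt (fun s => g (x, s)) (g (x, t) * Z (x, t)) t) : ContDiff ℝ ∞ g := by
  let L : 𝔸 × 𝔸 → ℝ × ℝ →L[ℝ] 𝔸 := fun q =>
    ((ContinuousLinearMap.fst ℝ ℝ ℝ).smulRight q.1) +
      ((ContinuousLinearMap.snd ℝ ℝ ℝ).smulRight q.2)
  have hL : ContDiff ℝ ∞ L :=
    (contDiff_const.smulRight contDiff_fst).add (contDiff_const.smulRight contDiff_snd)
  have hid : Continuous fun v : 𝔸 => (ContinuousLinearMap.id ℝ ℝ).smulRight v :=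
    (ContinuousLinearMap.smulRightL ℝ ℝ 𝔸 (ContinuousLinearMap.id ℝ ℝ)).continuous
  have hd : ∀ p, HasFDerivAt g (L (g p * A p, g p * Z p)) p := by
    intro p
    have := hasStrictFDerivAt_uncurry_coprod (u := p) (f := fun x t => g (x, t))
      (f₁ := fun x t => (ContinuousLinearMap.id ℝ ℝ).smulRight (g (x, t) * A (x, t)))
      (f₂ := fun x t => (ContinuousLinearMap.id ℝ ℝ).smulRight (g (x, t) * Z (x, t)))
      (Eventually.of_forall fun v => (hx v.1 v.2).hasFDerivAt)
      (Eventually.of_forall fun v => (ht v.1 v.2).hasFDerivAt)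
      (hid.comp (hg.mul hA.continuous)).continuousAt (hid.comp (hg.mul hZ.continuous)).continuousAt
    refine this.hasFDerivAt.congr_fderiv ?_
    ext <;> simp [L, Function.HasUncurry.uncurry]
  have hfd : fderiv ℝ g = fun p => L (g p * A p, g p * Z p) := funext fun p => (hd p).fderiv
  -- by the formula for the derivative, `g` of class `Cᵐ` is of class `Cᵐ⁺¹`
  rw [contDiff_infty]
  intro m
  induction m with
  | zero => exact contDiff_zero.2 hg
  | succ m ih =>
    rw [Nat.cast_succ, contDiff_succ_iff_fderiv]
    refine ⟨fun p => (hd p).differentiableAt, by simp, ?_⟩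
    rw [hfd]
    exact (hL.of_le (by exact_mod_cast le_top)).comp
      ((ih.mul (hA.of_le (by exact_mod_cast le_top))).prodMk
        (ih.mul (hZ.of_le (by exact_mod_cast le_top))))

/-- A flat smooth connection on `ℝ²` has a smooth parallel frame: transport first along the `t`-axis
and then in the direction of `x`. -/
theorem exists_parallel_frame [CompleteSpace 𝔸] {A Z : ℝ × ℝ → 𝔸} (hA : ContDiff ℝ ∞ A)
    (hZ : ContDiff ℝ ∞ Z)
    (hflat : ∀ p, fderiv ℝ A p (0, 1) = fderiv ℝ Z p (1, 0) + (A p * Z p - Z p * A p)) :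
    ∃ g : ℝ × ℝ → 𝔸, ContDiff ℝ ∞ g ∧ g (0, 0) = 1 ∧
      (∀ x t, HasDerivAt (fun y => g (y, t)) (g (x, t) * A (x, t)) x) ∧
      ∀ x t, HasDerivAt (fun s => g (x, s)) (g (x, t) * Z (x, t)) t := by
  obtain ⟨c, hc, hc0, hcd⟩ := exists_linear_ode (A := fun p => Z (0, p.1)) (c := fun _ => (1 : 𝔸))
    (hZ.continuous.comp (by fun_prop)) continuous_const
  obtain ⟨g, hg, hg0, hgd⟩ := exists_linear_ode (c := fun t => c (t, 0)) hA.continuous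
    (hc.comp (by fun_prop))
  have ht : ∀ x t, HasDerivAt (fun s => g (x, s)) (g (x, t) * Z (x, t)) t := fun x t => by
    refine hasDerivAt_parameter hA hZ hflat hg hgd ?_ x
    simp only [hg0]
    exact hcd t 0
  exact ⟨g, contDiff_of_partial hA hZ hg hgd ht, by rw [hg0, hc0], hgd, ht⟩

end ODE

/-! ### Matrix-valued functions -/

section MatrixCalculus

variable {n : ℕ}

/-- The matrix-valued function `A` has the entrywise derivative `A'` at `x`. -/
def HasMatDerivAt (A : ℝ → Matrix (Fin n) (Fin n) ℝ) (A' : Matrix (Fin n) (Fin n) ℝ) (x : ℝ) :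
    Prop :=
  ∀ i k, HasDerivAt (fun y => A y i k) (A' i k) x

theorem HasMatDerivAt.matDeriv {A : ℝ → Matrix (Fin n) (Fin n) ℝ} {A' : Matrix (Fin n) (Fin n) ℝ}
    {x : ℝ} (h : HasMatDerivAt A A' x) : matDeriv n A x = A' := by
  ext i k
  exact (h i k).deriv

theorem MatSmooth.hasMatDerivAt {A : ℝ → Matrix (Fin n) (Fin n) ℝ} (h : MatSmooth n A) (x : ℝ) :
    HasMatDerivAt A (matDeriv n A x) x := fun i k =>
  ((h i k).differentiable (by simp) x).hasDerivAt

theorem HasMatDerivAt.mul {A B : ℝ → Matrix (Fin n) (Fin n) ℝ} {A' B' : Matrix (Fin n) (Fin n) ℝ}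
    {x : ℝ} (hA : HasMatDerivAt A A' x) (hB : HasMatDerivAt B B' x) :
    HasMatDerivAt (fun y => A y * B y) (A' * B x + A x * B') x := fun i k => by
  simp only [Matrix.mul_apply, Matrix.add_apply, ← Finset.sum_add_distrib]
  exact HasDerivAt.fun_sum fun l _ => (hA i l).fun_mul (hB l k)

theorem HasMatDerivAt.const_add {A : ℝ → Matrix (Fin n) (Fin n) ℝ} {A' : Matrix (Fin n) (Fin n) ℝ}
    {x : ℝ} (hA : HasMatDerivAt A A' x) (M : Matrix (Fin n) (Fin n) ℝ) :
    HasMatDerivAt (fun y => M + A y) A' x := fun i k => (hA i k).const_add (M i k)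

/-- Liouville's formula: `g' = g B` implies `(det g)' = det g · tr B`. -/
theorem HasMatDerivAt.det {g : ℝ → Matrix (Fin n) (Fin n) ℝ} {B : Matrix (Fin n) (Fin n) ℝ} {x : ℝ}
    (hg : HasMatDerivAt g (g x * B) x) :
    HasDerivAt (fun y => (g y).det) ((g x).det * B.trace) x := by
  let D : ContinuousMultilinearMap ℝ (fun _ : Fin n => Fin n → ℝ) ℝ :=
    { (Matrix.detRowAlternating (R := ℝ) (n := Fin n)).toMultilinearMap with
      cont := by
        change Continuous fun M : Matrix (Fin n) (Fin n) ℝ => M.det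
        exact continuous_id.matrix_det }
  have h1 : HasDerivAt (fun y => fun k i => g y i k) (fun k i => (g x * B) i k) x :=
    hasDerivAt_pi.2 fun k => hasDerivAt_pi.2 fun i => hg i k
  have h2 := (D.hasFDerivAt (fun k i => g x i k)).comp_hasDerivAt x h1
  have h3 : (D ∘ fun y => fun k i => g y i k) = fun y => (g y).det := by
    funext y
    exact Matrix.det_transpose (g y)
  rw [h3] at h2
  refine h2.congr_deriv ?_
  rw [ContinuousMultilinearMap.linearDeriv_apply, Matrix.trace, Finset.mul_sum]
  refine Finset.sum_congr rfl fun i _ => ?_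
  have h4 : D (Function.update (fun k i => g x i k) i fun l => (g x * B) l i) =
      ((g x).updateCol i fun k => ∑ l, B l i • g x k l).det := by
    rw [← Matrix.det_transpose]
    change Matrix.det _ = Matrix.det _
    congr 1
    ext k l
    rw [transpose_apply]
    by_cases hk : k = i
    · subst hk
      rw [Function.update_self, Matrix.updateCol_self, Matrix.mul_apply]
      exact Finset.sum_congr rfl fun m _ => mul_comm _ _
    · rw [Function.update_of_ne hk, Matrix.updateCol_ne hk]
  rw [h4, Matrix.det_updateCol_sum, smul_eq_mul, mul_comm, diag_apply]

theorem contDiff_det {E : Type*} [NormedAddCommGroup E] [NormedSpace ℝ E]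
    {A : E → Matrix (Fin n) (Fin n) ℝ} (hA : ∀ i k, ContDiff ℝ ∞ fun p => A p i k) :
    ContDiff ℝ ∞ fun p => (A p).det := by
  simp only [Matrix.det_apply]
  exact ContDiff.sum fun σ _ => (contDiff_prod fun i _ => hA _ _).const_smul _

section Norm

open scoped Matrix.Norms.Operator

theorem hasMatDerivAt_iff_hasDerivAt {A : ℝ → Matrix (Fin n) (Fin n) ℝ}
    {A' : Matrix (Fin n) (Fin n) ℝ} {x : ℝ} : HasMatDerivAt A A' x ↔ HasDerivAt A A' x := by
  constructor
  · intro h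
    have h1 : ∀ M : Matrix (Fin n) (Fin n) ℝ, M = ∑ i, ∑ k, M i k • Matrix.single i k (1 : ℝ) :=
      fun M => by
        conv_lhs => rw [Matrix.matrix_eq_sum_single M]
        simp [Matrix.smul_single]
    rw [h1 A', show A = fun y => ∑ i, ∑ k, A y i k • Matrix.single i k (1 : ℝ) from
      funext fun y => h1 (A y)]
    exact HasDerivAt.fun_sum fun i _ => HasDerivAt.fun_sum fun k _ => (h i k).smul_const _
  · intro h i k
    exact (LinearMap.toContinuousLinearMap
      (Matrix.entryLinearMap ℝ ℝ i k)).hasFDerivAt.comp_hasDerivAt x h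

theorem contDiff_iff_entries {E : Type*} [NormedAddCommGroup E] [NormedSpace ℝ E]
    {A : E → Matrix (Fin n) (Fin n) ℝ} :
    (∀ i k, ContDiff ℝ ∞ fun p => A p i k) ↔ ContDiff ℝ ∞ A := by
  constructor
  · intro h
    have h1 : ∀ M : Matrix (Fin n) (Fin n) ℝ, M = ∑ i, ∑ k, M i k • Matrix.single i k (1 : ℝ) :=
      fun M => by
        conv_lhs => rw [Matrix.matrix_eq_sum_single M]
        simp [Matrix.smul_single]
    rw [show A = fun y => ∑ i, ∑ k, A y i k • Matrix.single i k (1 : ℝ) from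
      funext fun y => h1 (A y)]
    exact ContDiff.sum fun i _ => ContDiff.sum fun k _ => (h i k).smul contDiff_const
  · intro h i k
    exact (LinearMap.toContinuousLinearMap (Matrix.entryLinearMap ℝ ℝ i k)).contDiff.comp h

/-- The initial value problem `h' = h A` has at most one solution. -/
theorem eq_of_linear_ode {A h₁ h₂ : ℝ → Matrix (Fin n) (Fin n) ℝ}
    (hA : MatSmooth n A) (h₁' : ∀ x, HasMatDerivAt h₁ (h₁ x * A x) x)
    (h₂' : ∀ x, HasMatDerivAt h₂ (h₂ x * A x) x) (h0 : h₁ 0 = h₂ 0) : h₁ = h₂ := by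
  funext x
  have hAc : Continuous A := (contDiff_iff_entries.1 hA).continuous
  obtain ⟨C, hC⟩ := (isCompact_Icc (a := -|x|) (b := |x|)).exists_bound_of_continuousOn
    hAc.continuousOn
  have hd : ∀ s, HasDerivAt (fun s => h₁ s - h₂ s) ((h₁ s - h₂ s) * A s) s := fun s => by
    rw [sub_mul]
    exact (hasMatDerivAt_iff_hasDerivAt.1 (h₁' s)).fun_sub (hasMatDerivAt_iff_hasDerivAt.1 (h₂' s))
  have h := norm_le_gronwallBound_abs (C := C) (η := 0) hd (fun s hs => by
    rw [add_zero, mul_comm C]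
    exact (norm_mul_le _ _).trans (mul_le_mul_of_nonneg_left (hC s (abs_le.1 hs))
      (norm_nonneg _))) (x := x) le_rfl
  simp only [h0, sub_self, norm_zero, gronwallBound_ε0_δ0] at h
  exact sub_eq_zero.1 (norm_le_zero_iff.1 h)

/-- A smooth flat connection with traceless coefficients has a smooth parallel frame of
determinant `1`. -/
theorem exists_unimodular_frame {A Z : ℝ → ℝ → Matrix (Fin n) (Fin n) ℝ}
    (hA : ∀ i k, ContDiff ℝ ∞ fun p : ℝ × ℝ => A p.1 p.2 i k)
    (hZ : ∀ i k, ContDiff ℝ ∞ fun p : ℝ × ℝ => Z p.1 p.2 i k)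
    (hflat : ∀ x t, matDeriv n (fun s => A x s) t =
      matDeriv n (fun y => Z y t) x + (A x t * Z x t - Z x t * A x t))
    (hAtr : ∀ x t, (A x t).trace = 0) (hZtr : ∀ x t, (Z x t).trace = 0) :
    ∃ g : ℝ → ℝ → Matrix (Fin n) (Fin n) ℝ,
      (∀ i k, ContDiff ℝ ∞ fun p : ℝ × ℝ => g p.1 p.2 i k) ∧ (∀ x t, (g x t).det = 1) ∧
      (∀ x t, HasMatDerivAt (fun y => g y t) (g x t * A x t) x) ∧
      ∀ x t, HasMatDerivAt (fun s => g x s) (g x t * Z x t) t := by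
  have hA' : ContDiff ℝ ∞ fun p : ℝ × ℝ => A p.1 p.2 := contDiff_iff_entries.1 hA
  have hZ' : ContDiff ℝ ∞ fun p : ℝ × ℝ => Z p.1 p.2 := contDiff_iff_entries.1 hZ
  obtain ⟨g, hg, hg0, hgx, hgt⟩ := exists_parallel_frame hA' hZ' (by
    rintro ⟨x, t⟩
    have ht : HasDerivAt (fun s : ℝ => (x, s)) (0, 1) t :=
      (hasDerivAt_const t x).prodMk (hasDerivAt_id t)
    have hx : HasDerivAt (fun y : ℝ => (y, t)) (1, 0) x :=
      (hasDerivAt_id x).prodMk (hasDerivAt_const x t)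
    have h1 : HasDerivAt (fun s => A x s) (fderiv ℝ (fun p : ℝ × ℝ => A p.1 p.2) (x, t) (0, 1)) t :=
      (hA'.differentiable (by simp) (x, t)).hasFDerivAt.comp_hasDerivAt t ht
    have h2 : HasDerivAt (fun y => Z y t) (fderiv ℝ (fun p : ℝ × ℝ => Z p.1 p.2) (x, t) (1, 0)) x :=
      HasFDerivAt.comp_hasDerivAt (l := fun p : ℝ × ℝ => Z p.1 p.2) x
        (hZ'.differentiable (by simp) (x, t)).hasFDerivAt hx
    have h3 := hflat x t
    rw [(hasMatDerivAt_iff_hasDerivAt.2 h1).matDeriv,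
      (hasMatDerivAt_iff_hasDerivAt.2 h2).matDeriv] at h3
    exact h3)
  have hgx' : ∀ x t, HasMatDerivAt (fun y => g (y, t)) (g (x, t) * A x t) x := fun x t =>
    hasMatDerivAt_iff_hasDerivAt.2 (hgx x t)
  have hgt' : ∀ x t, HasMatDerivAt (fun s => g (x, s)) (g (x, t) * Z x t) t := fun x t =>
    hasMatDerivAt_iff_hasDerivAt.2 (hgt x t)
  refine ⟨fun x t => g (x, t), contDiff_iff_entries.2 hg, fun x t => ?_, hgx', hgt'⟩
  have h1 : ∀ x t, HasDerivAt (fun y => (g (y, t)).det) 0 x := fun x t => by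
    have := (hgx' x t).det
    rwa [hAtr, mul_zero] at this
  have h2 : ∀ t, HasDerivAt (fun s => (g (0, s)).det) 0 t := fun t => by
    have := (hgt' 0 t).det
    rwa [hZtr, mul_zero] at this
  have h3 := is_const_of_deriv_eq_zero (fun x => (h1 x t).differentiableAt)
    (fun x => (h1 x t).deriv) x 0
  have h4 := is_const_of_deriv_eq_zero (fun s => (h2 s).differentiableAt)
    (fun s => (h2 s).deriv) t 0
  rw [h3, h4, hg0, Matrix.det_one]

end Norm

end MatrixCalculus

/-! ### Moving frames -/

section Frames

variable {n : ℕ}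

theorem inV_curvature (γ : ℝ → Fin n → ℝ) (x : ℝ) : InV n (curvature n γ x) := fun i k h => by
  rw [curvature, of_apply, if_neg h]

theorem trace_bMat_add {u : Matrix (Fin n) (Fin n) ℝ} (hu : InV n u) : (bMat n + u).trace = 0 := by
  refine Finset.sum_eq_zero fun i _ => ?_
  rw [diag_apply, Matrix.add_apply, hu i i (by omega), bMat, of_apply, if_neg (by omega), add_zero]

theorem mul_bMat_add_apply {u : Matrix (Fin n) (Fin n) ℝ} (hu : InV n u)
    (Z : Matrix (Fin n) (Fin n) ℝ) (i : Fin n) {k : Fin n} (hk : (k : ℕ) + 1 < n) :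
    (Z * (bMat n + u)) i k = Z i ⟨k + 1, hk⟩ :=
  mul_bMatR_add_apply hu Z i hk

theorem hasDerivAt_iteratedDeriv {γ : ℝ → Fin n → ℝ} (h : ContDiff ℝ ∞ γ) (k : ℕ) (x : ℝ)
    (i : Fin n) : HasDerivAt (fun y => iteratedDeriv k γ y i) (iteratedDeriv (k + 1) γ x i) x := by
  have hd : DifferentiableAt ℝ (iteratedDeriv k γ) x :=
    (h.differentiable_iteratedDeriv k (by exact_mod_cast WithTop.coe_lt_top k)) x
  rw [iteratedDeriv_succ]
  exact hasDerivAt_pi.1 hd.hasDerivAt i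

/-- The Frenet equation `g_x = g (b + u)`. The `n`-th derivative is expanded in the frame by
Cramer's rule; its last coefficient is the logarithmic derivative of `det g = 1`. -/
theorem IsArcLengthCurve.hasMatDerivAt_frame (hn : 2 ≤ n) {γ : ℝ → Fin n → ℝ}
    (hγ : IsArcLengthCurve n γ) (x : ℝ) :
    HasMatDerivAt (frame n γ) (frame n γ x * (bMat n + curvature n γ x)) x := by
  set c : Fin n → ℝ := Matrix.cramer (frame n γ x) (iteratedDeriv n γ x) with hc
  set C : Matrix (Fin n) (Fin n) ℝ := Matrix.of fun i k => if (k : ℕ) + 1 = n then c i else 0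
    with hC
  have h1 : HasMatDerivAt (frame n γ) (frame n γ x * (bMat n + C)) x := fun i k => by
    have h2 := hasDerivAt_iteratedDeriv hγ.smooth k x i
    refine h2.congr_deriv ?_
    by_cases hk : (k : ℕ) + 1 = n
    · have h3 : frame n γ x *ᵥ c = iteratedDeriv n γ x := by
        rw [hc, Matrix.mulVec_cramer, hγ.det_frame, one_smul]
      rw [hk, ← h3, Matrix.mul_apply, mulVec, dotProduct]
      refine Finset.sum_congr rfl fun l _ => ?_
      have hl : ¬ (l : ℕ) = n := by have := l.2; omega
      simp [bMat, hC, hk, hl]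
    · have hk' : (k : ℕ) + 1 < n := by have := k.2; omega
      rw [Matrix.mul_apply, Finset.sum_eq_single ⟨k + 1, hk'⟩]
      · simp [frame, bMat, hC, hk]
      · intro l _ hl
        have : ¬ (l : ℕ) = k + 1 := fun h => hl (Fin.ext h)
        simp [bMat, hC, hk, this]
      · simp
  have h2 := h1.det
  have h3 : HasDerivAt (fun y => (frame n γ y).det) 0 x := by
    simp only [hγ.det_frame]
    exact hasDerivAt_const x 1
  have h4 := h2.unique h3
  have htr : (bMat n + C).trace = c ⟨n - 1, by omega⟩ := by
    rw [Matrix.trace, Finset.sum_eq_single ⟨n - 1, by omega⟩]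
    · rw [diag_apply, Matrix.add_apply, bMat, of_apply, if_neg (by simp), hC, of_apply,
        if_pos (by simp only; omega), zero_add]
    · intro l _ hl
      have : ¬ (l : ℕ) + 1 = n := fun h => hl (Fin.ext (by simp only; omega))
      simp [bMat, hC, this]
    · simp
  rw [hγ.det_frame, one_mul, htr] at h4
  have h5 : C = curvature n γ x := by
    ext i k
    rw [hC, of_apply, curvature, of_apply]
    by_cases hk : (k : ℕ) + 1 = n
    · by_cases hi : (i : ℕ) + 1 < n
      · rw [if_pos hk, if_pos ⟨hk, hi⟩, hc, Matrix.cramer_apply]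
      · rw [if_pos hk, if_neg (by omega), ← h4]
        congr 1
        have := i.2
        ext
        simp only
        omega
    · rw [if_neg hk, if_neg (by omega)]
  rwa [← h5]

/-- A unimodular solution of the Frenet equation is the moving frame of its first column, and the
coefficient `u` of the equation is the curvature. -/
theorem frame_eq_of_hasMatDerivAt (hn : 2 ≤ n) {g u : ℝ → Matrix (Fin n) (Fin n) ℝ}
    (hg : MatSmooth n g) (hu : ∀ x, InV n (u x)) (hdet : ∀ x, (g x).det = 1)
    (hgx : ∀ x, HasMatDerivAt g (g x * (bMat n + u x)) x) :
    IsArcLengthCurve n (fun x i => g x i ⟨0, by omega⟩) ∧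
      frame n (fun x i => g x i ⟨0, by omega⟩) = g ∧
      curvature n (fun x i => g x i ⟨0, by omega⟩) = u := by
  set γ : ℝ → Fin n → ℝ := fun x i => g x i ⟨0, by omega⟩ with hγ
  have hγs : ContDiff ℝ ∞ γ := contDiff_pi.2 fun i => hg i _
  have hit : ∀ k : ℕ, ∀ hk : k < n, ∀ x i, iteratedDeriv k γ x i = g x i ⟨k, hk⟩ := by
    intro k
    induction k with
    | zero => intro hk x i; simp [hγ]
    | succ k ih =>
      intro hk x i
      have hkn : k < n := by omega
      have h1 := hasDerivAt_iteratedDeriv hγs k x i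
      have h2 := hgx x i ⟨k, hkn⟩
      rw [mul_bMat_add_apply (hu x) _ _ hk] at h2
      simp only [ih hkn] at h1
      exact h1.unique h2
  have hframe : frame n γ = g := by
    funext x
    ext i k
    exact hit k k.2 x i
  refine ⟨⟨hγs, fun x => by rw [hframe, hdet]⟩, hframe, ?_⟩
  funext x
  have hlast : n - 1 + 1 = n := by omega
  have hn1 : iteratedDeriv n γ x = fun k => ∑ l, u x l ⟨n - 1, by omega⟩ • g x k l := by
    funext i
    have h1 := hasDerivAt_iteratedDeriv hγs (n - 1) x i
    have h2 := hgx x i ⟨n - 1, by omega⟩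
    simp only [hit (n - 1) (by omega)] at h1
    rw [hlast] at h1
    rw [h1.unique h2, Matrix.mul_apply]
    refine Finset.sum_congr rfl fun l _ => ?_
    have hb : bMat n l ⟨n - 1, by omega⟩ = 0 := by
      rw [bMat, of_apply, if_neg]
      have := l.2
      simp only
      omega
    rw [Matrix.add_apply, hb, zero_add, smul_eq_mul, mul_comm]
  ext i k
  rw [curvature, of_apply]
  split_ifs with h
  · have hk : k = ⟨n - 1, by omega⟩ := Fin.ext (by simp only; omega)
    rw [hn1, hframe, Matrix.det_updateCol_sum, hdet, smul_eq_mul, mul_one, hk]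
  · exact (hu x i k h).symm

end Frames

/-! ### Curve flows and zero curvature -/

section Flows

variable {n j : ℕ}

section Partial

variable {f a b : ℝ → ℝ → ℝ}

/-- The partial derivative of a smooth function with respect to the first variable is smooth. -/
theorem contDiff_of_hasDerivAt_left (hf : ContDiff ℝ ∞ fun p : ℝ × ℝ => f p.1 p.2)
    (ha : ∀ x t, HasDerivAt (fun y => f y t) (a x t) x) :
    ContDiff ℝ ∞ fun p : ℝ × ℝ => a p.1 p.2 := by
  have h : (fun p : ℝ × ℝ => a p.1 p.2) =
      fun p => fderiv ℝ (fun p : ℝ × ℝ => f p.1 p.2) p (1, 0) := by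
    funext ⟨x, t⟩
    have hx : HasDerivAt (fun y : ℝ => (y, t)) (1, 0) x :=
      (hasDerivAt_id x).prodMk (hasDerivAt_const x t)
    exact (ha x t).unique (HasFDerivAt.comp_hasDerivAt (l := fun p : ℝ × ℝ => f p.1 p.2) x
      (hf.differentiable (by simp) (x, t)).hasFDerivAt hx)
  rw [h]
  exact (hf.fderiv_right (m := ∞) (by simp)).clm_apply contDiff_const

/-- Symmetry of mixed partial derivatives. -/
theorem deriv_comm_of_hasDerivAt (hf : ContDiff ℝ ∞ fun p : ℝ × ℝ => f p.1 p.2)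
    (ha : ∀ x t, HasDerivAt (fun y => f y t) (a x t) x)
    (hb : ∀ x t, HasDerivAt (fun s => f x s) (b x t) t) (x t : ℝ) :
    deriv (fun s => a x s) t = deriv (fun y => b y t) x := by
  set F : ℝ × ℝ → ℝ := fun p => f p.1 p.2 with hF
  have hx : ∀ x t : ℝ, HasDerivAt (fun y : ℝ => (y, t)) ((1, 0) : ℝ × ℝ) x := fun x t =>
    (hasDerivAt_id x).prodMk (hasDerivAt_const x t)
  have ht : ∀ x t : ℝ, HasDerivAt (fun s : ℝ => (x, s)) ((0, 1) : ℝ × ℝ) t := fun x t =>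
    (hasDerivAt_const t x).prodMk (hasDerivAt_id t)
  have ha' : ∀ x t, a x t = fderiv ℝ F (x, t) (1, 0) := fun x t =>
    (ha x t).unique (HasFDerivAt.comp_hasDerivAt (l := F) x
      (hf.differentiable (by simp) (x, t)).hasFDerivAt (hx x t))
  have hb' : ∀ x t, b x t = fderiv ℝ F (x, t) (0, 1) := fun x t =>
    (hb x t).unique (HasFDerivAt.comp_hasDerivAt (l := F) t
      (hf.differentiable (by simp) (x, t)).hasFDerivAt (ht x t))
  simp only [ha', hb']
  have hd : DifferentiableAt ℝ (fderiv ℝ F) (x, t) :=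
    (hf.fderiv_right (m := ∞) (by simp)).differentiable (by simp) (x, t)
  have h1 : HasDerivAt (fun s => fderiv ℝ F (x, s)) (fderiv ℝ (fderiv ℝ F) (x, t) (0, 1)) t :=
    HasFDerivAt.comp_hasDerivAt (l := fderiv ℝ F) t hd.hasFDerivAt (ht x t)
  have h2 : HasDerivAt (fun y => fderiv ℝ F (y, t)) (fderiv ℝ (fderiv ℝ F) (x, t) (1, 0)) x :=
    HasFDerivAt.comp_hasDerivAt (l := fderiv ℝ F) x hd.hasFDerivAt (hx x t)
  have hsymm : IsSymmSndFDerivAt ℝ F (x, t) :=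
    hf.contDiffAt.isSymmSndFDerivAt (by
      rw [minSmoothness_of_isRCLikeNormedField]
      exact WithTop.coe_le_coe.2 le_top)
  rw [(h1.clm_apply (hasDerivAt_const t _)).deriv, (h2.clm_apply (hasDerivAt_const x _)).deriv]
  simp only [map_zero, add_zero]
  exact hsymm _ _

theorem matSmooth_left {A : ℝ → ℝ → Matrix (Fin n) (Fin n) ℝ}
    (hA : ∀ i k, ContDiff ℝ ∞ fun p : ℝ × ℝ => A p.1 p.2 i k) (t : ℝ) :
    MatSmooth n fun x => A x t := fun i k =>
  (hA i k).comp (contDiff_id.prodMk contDiff_const)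

theorem matSmooth_right {A : ℝ → ℝ → Matrix (Fin n) (Fin n) ℝ}
    (hA : ∀ i k, ContDiff ℝ ∞ fun p : ℝ × ℝ => A p.1 p.2 i k) (x : ℝ) :
    MatSmooth n fun t => A x t := fun i k =>
  (hA i k).comp (contDiff_const.prodMk contDiff_id)

end Partial

section Family

variable {γ : ℝ → ℝ → Fin n → ℝ}

theorem contDiff_iteratedDeriv_left (hγ : ContDiff ℝ ∞ fun p : ℝ × ℝ => γ p.1 p.2) (k : ℕ)
    (i : Fin n) : ContDiff ℝ ∞ fun p : ℝ × ℝ => iteratedDeriv k (fun y => γ y p.2) p.1 i := by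
  have hs : ∀ t, ContDiff ℝ ∞ fun y => γ y t := fun t =>
    hγ.comp (contDiff_id.prodMk contDiff_const)
  induction k with
  | zero => simpa using contDiff_pi.1 hγ i
  | succ k ih =>
    exact contDiff_of_hasDerivAt_left
      (f := fun x t => iteratedDeriv k (fun y => γ y t) x i)
      (a := fun x t => iteratedDeriv (k + 1) (fun y => γ y t) x i) ih
      fun x t => hasDerivAt_iteratedDeriv (hs t) k x i

theorem contDiff_frame (hγ : ContDiff ℝ ∞ fun p : ℝ × ℝ => γ p.1 p.2) (i k : Fin n) :
    ContDiff ℝ ∞ fun p : ℝ × ℝ => frame n (fun y => γ y p.2) p.1 i k :=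
  contDiff_iteratedDeriv_left hγ k i

theorem contDiff_curvature (hγ : ContDiff ℝ ∞ fun p : ℝ × ℝ => γ p.1 p.2) (i k : Fin n) :
    ContDiff ℝ ∞ fun p : ℝ × ℝ => curvature n (fun y => γ y p.2) p.1 i k := by
  simp only [curvature, of_apply]
  split_ifs
  · refine contDiff_det fun l m => ?_
    by_cases hm : m = i
    · subst hm
      simp only [Matrix.updateCol_self]
      exact contDiff_iteratedDeriv_left hγ n l
    · simp only [Matrix.updateCol_ne hm]
      exact contDiff_frame hγ l m
  · exact contDiff_const

end Family

theorem mulVec_firstVec (hn : 2 ≤ n) (A : Matrix (Fin n) (Fin n) ℝ) (i : Fin n) :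
    (A *ᵥ firstVec n) i = A i ⟨0, by omega⟩ := by
  rw [mulVec, dotProduct, Finset.sum_eq_single ⟨0, by omega⟩]
  · simp [firstVec]
  · intro l _ hl
    have : ¬ (l : ℕ) = 0 := fun h => hl (Fin.ext h)
    simp [firstVec, this]
  · simp

namespace IsCurveFlowSolution

variable {γ : ℝ → ℝ → Fin n → ℝ}

/-- Along a solution of the curve flow, `Z_{j,0}(u)` is smooth in `(x, t)` and
`[∂_x + b + u, Z_{j,0}(u)] ∈ Vₙ`. -/
theorem zj0_spec (hn : 2 ≤ n) (hj : ¬ n ∣ j) (h : IsCurveFlowSolution n j γ) :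
    (∀ i k, ContDiff ℝ ∞ fun p : ℝ × ℝ =>
      Zj0 n j (fun y => curvature n (fun z => γ z p.2) y) p.1 i k) ∧
    ∀ x t, InV n (bracket n (curvature n fun z => γ z t)
      (Zj0 n j (curvature n fun z => γ z t)) x) := by
  obtain ⟨h1, -, h3⟩ := Zj0_spec hn hj (u := fun x t => curvature n (fun z => γ z t) x)
    (contDiff_curvature h.smooth) fun x t => inV_curvature _ x
  exact ⟨h1, h3⟩

/-- The moving frame of a solution of the curve flow satisfies `g_t = g Z`. For the first column
this is the flow; the other columns follow from it by differentiation in `x`, since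
`[∂_x + b + u, Z] ∈ Vₙ` has zero columns except for the last one. -/
theorem hasMatDerivAt_frame (hn : 2 ≤ n) (hj : ¬ n ∣ j) (h : IsCurveFlowSolution n j γ) (x t : ℝ) :
    HasMatDerivAt (fun s => frame n (fun y => γ y s) x)
      (frame n (fun y => γ y t) x * Zj0 n j (curvature n fun y => γ y t) x) t := by
  obtain ⟨hZ, hb⟩ := h.zj0_spec hn hj
  have key : ∀ k : ℕ, ∀ hk : k < n, ∀ (i : Fin n) (x t : ℝ),
      HasDerivAt (fun s => iteratedDeriv k (fun y => γ y s) x i)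
        ((frame n (fun y => γ y t) x * Zj0 n j (curvature n fun y => γ y t) x) i ⟨k, hk⟩) t := by
    intro k
    induction k with
    | zero =>
      intro hk i x t
      have hs : ContDiff ℝ ∞ fun s => γ x s := h.smooth.comp (contDiff_const.prodMk contDiff_id)
      have h1 := hasDerivAt_pi.1 (hs.differentiable (by simp) t).hasDerivAt i
      rw [h.flow, mulVec_firstVec hn] at h1
      simpa using h1
    | succ k ih =>
      intro hk i x t
      have hkn : k < n := by omega
      have h1 := deriv_comm_of_hasDerivAt
        (f := fun x t => iteratedDeriv k (fun y => γ y t) x i)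
        (a := fun x t => iteratedDeriv (k + 1) (fun y => γ y t) x i)
        (contDiff_iteratedDeriv_left h.smooth k i)
        (fun x t => hasDerivAt_iteratedDeriv (h.mem t).smooth k x i) (ih hkn i) x t
      have hs : ContDiff ℝ ∞ fun s => iteratedDeriv (k + 1) (fun y => γ y s) x i :=
        (contDiff_iteratedDeriv_left h.smooth (k + 1) i).comp (contDiff_const.prodMk contDiff_id)
      have h2 := (hs.differentiable (by simp) t).hasDerivAt
      rw [h1] at h2
      refine h2.congr_deriv ?_
      have h3 := (((h.mem t).hasMatDerivAt_frame hn x).mul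
        ((matSmooth_left (A := fun x t => Zj0 n j (curvature n fun y => γ y t) x)
          hZ t).hasMatDerivAt x)) i ⟨k, hkn⟩
      refine h3.deriv.trans ?_
      rw [Matrix.mul_assoc, ← Matrix.mul_add, Matrix.mul_apply, Matrix.mul_apply]
      refine Finset.sum_congr rfl fun l _ => ?_
      have hcol := InV.col_eq (fun x => inV_curvature (fun y => γ y t) x) (hb x t) l
        (k := ⟨k, hkn⟩) hk
      exact congrArg (frame n (fun y => γ y t) x i l * ·) ((add_comm _ _).trans hcol.symm)
  exact fun i k => key k k.2 i x t

/-- The curvature of a solution of the curve flow solves the KdV flow: the compatibility condition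
of `g_x = g (b + u)` and `g_t = g Z`. -/
theorem isKdVSolution (hn : 2 ≤ n) (hj : ¬ n ∣ j) (h : IsCurveFlowSolution n j γ) :
    IsKdVSolution n j fun x t => curvature n (fun y => γ y t) x where
  smooth := contDiff_curvature h.smooth
  mem x t := inV_curvature _ x
  flow x t := by
    obtain ⟨hZ, -⟩ := h.zj0_spec hn hj
    have hu := (matSmooth_right (A := fun x t => curvature n (fun y => γ y t) x)
      (contDiff_curvature h.smooth) x).hasMatDerivAt t
    have h1 := (h.hasMatDerivAt_frame hn hj x t).mul (hu.const_add (bMat n))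
    have h2 := ((h.mem t).hasMatDerivAt_frame hn x).mul ((matSmooth_left
      (A := fun x t => Zj0 n j (curvature n fun y => γ y t) x) hZ t).hasMatDerivAt x)
    have h3 : matDeriv n (fun s => frame n (fun y => γ y s) x *
        (bMat n + curvature n (fun y => γ y s) x)) t =
        matDeriv n (fun y => frame n (fun z => γ z t) y * Zj0 n j (curvature n fun z => γ z t) y)
          x := by
      ext i k
      exact deriv_comm_of_hasDerivAt (f := fun x t => frame n (fun y => γ y t) x i k)
        (a := fun x t => (frame n (fun y => γ y t) x *
          (bMat n + curvature n (fun y => γ y t) x)) i k)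
        (b := fun x t => (frame n (fun y => γ y t) x *
          Zj0 n j (curvature n fun y => γ y t) x) i k) (contDiff_frame h.smooth i k)
        (fun x t => (h.mem t).hasMatDerivAt_frame hn x i k)
        (fun x t => h.hasMatDerivAt_frame hn hj x t i k) x t
    rw [h1.matDeriv] at h3
    have h4 := h3.trans h2.matDeriv
    have hunit : IsUnit (frame n (fun y => γ y t) x) := by
      rw [Matrix.isUnit_iff_isUnit_det, (h.mem t).det_frame]
      exact isUnit_one
    refine hunit.mul_left_cancel ?_
    rw [bracket, Matrix.mul_add, Matrix.mul_sub, ← Matrix.mul_assoc, ← Matrix.mul_assoc]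
    rw [← sub_eq_iff_eq_add'.2 h4.symm]
    abel

/-- Solutions of the curve flow with the same curvature differ by an element of `SL(n, ℝ)`: their
frames solve the same linear equations in `x` and in `t`. -/
theorem exists_eq_mulVec (hn : 2 ≤ n) (hj : ¬ n ∣ j) {γ₁ γ₂ : ℝ → ℝ → Fin n → ℝ}
    (h₁ : IsCurveFlowSolution n j γ₁) (h₂ : IsCurveFlowSolution n j γ₂)
    (hc : ∀ t, curvature n (fun x => γ₁ x t) = curvature n (fun x => γ₂ x t)) :
    ∃ c₀ : Matrix.SpecialLinearGroup (Fin n) ℝ, ∀ x t,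
      γ₂ x t = (c₀ : Matrix (Fin n) (Fin n) ℝ) *ᵥ γ₁ x t := by
  have hdet : IsUnit (frame n (fun y => γ₁ y 0) 0).det := by
    rw [(h₁.mem 0).det_frame]
    exact isUnit_one
  -- `c₀` matches the two frames at the origin
  let c₀ : Matrix.SpecialLinearGroup (Fin n) ℝ :=
    ⟨frame n (fun y => γ₂ y 0) 0 * (frame n (fun y => γ₁ y 0) 0)⁻¹, by
      rw [Matrix.det_mul, Matrix.det_nonsing_inv, (h₁.mem 0).det_frame, (h₂.mem 0).det_frame]
      simp⟩
  set γ₃ : ℝ → ℝ → Fin n → ℝ := fun x t => (c₀ : Matrix (Fin n) (Fin n) ℝ) *ᵥ γ₁ x t with hγ₃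
  have h₃ : IsCurveFlowSolution n j γ₃ := h₁.smul c₀
  have hc₃ : ∀ t, curvature n (fun x => γ₃ x t) = curvature n (fun x => γ₂ x t) := fun t => by
    rw [← hc t]
    exact curvature_mulVec c₀ (h₁.mem t).smooth
  have h00 : frame n (fun y => γ₃ y 0) 0 = frame n (fun y => γ₂ y 0) 0 := by
    refine (frame_mulVec _ (h₁.mem 0).smooth 0).trans ?_
    exact Matrix.nonsing_inv_mul_cancel_right _ _ hdet
  have ht : (fun t => frame n (fun y => γ₃ y t) 0) = fun t => frame n (fun y => γ₂ y t) 0 := by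
    refine eq_of_linear_ode (A := fun t => Zj0 n j (curvature n fun y => γ₂ y t) 0)
      (matSmooth_right (A := fun x t => Zj0 n j (curvature n fun y => γ₂ y t) x)
        (h₂.zj0_spec hn hj).1 0) (fun t => ?_)
      (fun t => h₂.hasMatDerivAt_frame hn hj 0 t) h00
    have := h₃.hasMatDerivAt_frame hn hj 0 t
    rwa [hc₃] at this
  have hx : ∀ t, frame n (fun y => γ₃ y t) = frame n (fun y => γ₂ y t) := fun t => by
    refine eq_of_linear_ode (A := fun x => bMat n + curvature n (fun y => γ₂ y t) x)
      (fun i k => contDiff_const.add (matSmooth_left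
        (A := fun x t => curvature n (fun y => γ₂ y t) x) (contDiff_curvature h₂.smooth) t i k))
      (fun x => ?_) (fun x => (h₂.mem t).hasMatDerivAt_frame hn x) (congrFun ht t)
    have := (h₃.mem t).hasMatDerivAt_frame hn x
    rwa [hc₃] at this
  refine ⟨c₀, fun x t => ?_⟩
  funext i
  have := congrFun (congrFun (congrFun (hx t) x) i) ⟨0, by omega⟩
  simpa [frame, hγ₃] using this.symm

end IsCurveFlowSolution

/-- Every solution of the KdV flow is the curvature of a solution of the curve flow: the first
column of a parallel frame of the flat connection `(b + u, Z)`. -/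
theorem IsKdVSolution.exists_isCurveFlowSolution (hn : 2 ≤ n) (hj : ¬ n ∣ j)
    {u : ℝ → ℝ → Matrix (Fin n) (Fin n) ℝ} (hu : IsKdVSolution n j u) :
    ∃ γ : ℝ → ℝ → Fin n → ℝ, IsCurveFlowSolution n j γ ∧
      ∀ t, curvature n (fun x => γ x t) = fun x => u x t := by
  obtain ⟨hZ, hZtr, -⟩ := Zj0_spec hn hj hu.smooth hu.mem
  obtain ⟨g, hg, hdet, hgx, hgt⟩ := exists_unimodular_frame
    (A := fun x t => bMat n + u x t) (Z := fun x t => Zj0 n j (fun y => u y t) x)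
    (fun i k => contDiff_const.add (hu.smooth i k)) hZ (fun x t => by
      have h1 := ((matSmooth_right hu.smooth x).hasMatDerivAt t).const_add (bMat n)
      rw [h1.matDeriv, hu.flow]
      rfl) (fun x t => trace_bMat_add (hu.mem x t)) hZtr
  have key := fun t => frame_eq_of_hasMatDerivAt hn (matSmooth_left hg t) (fun x => hu.mem x t)
    (fun x => hdet x t) fun x => hgx x t
  refine ⟨fun x t i => g x t i ⟨0, by omega⟩, ⟨contDiff_pi.2 fun i => hg i _,
    fun t => (key t).1, fun x t => ?_⟩, fun t => (key t).2.2⟩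
  rw [(key t).2.1, (key t).2.2]
  refine HasDerivAt.deriv (hasDerivAt_pi.2 fun i => ?_)
  rw [mulVec_firstVec hn]
  exact hgt x t i _

end Flows

end CentralAffine

open CentralAffine in
/-- `n ≥ 2`, `j ≢ 0 (mod n)` (hence `j ≥ 1`). Two solutions of the `j`-th central affine curve
flow have the same central affine curvature iff they differ by a constant of `SL(n, ℝ)`; and the
central affine curvature map descends to a bijection from solutions of the curve flow modulo
`SL(n, ℝ)` onto solutions of the `j`-th `A^{(1)}_{n-1}`-KdV flow. -/
theorem mainTheorem1 (n j : ℕ) (hn : 2 ≤ n) (hj : ¬ n ∣ j) :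
    (∀ γ₁ γ₂ : ℝ → ℝ → Fin n → ℝ,
      IsCurveFlowSolution n j γ₁ → IsCurveFlowSolution n j γ₂ →
      ((∀ t, curvature n (fun x => γ₁ x t) = curvature n (fun x => γ₂ x t)) ↔
        ∃ c₀ : Matrix.SpecialLinearGroup (Fin n) ℝ, ∀ x t,
          γ₂ x t = (c₀ : Matrix (Fin n) (Fin n) ℝ).mulVec (γ₁ x t))) ∧
    ∃ F : MulAction.orbitRel.Quotient (Matrix.SpecialLinearGroup (Fin n) ℝ)
        (CurveFlowSolution n j) → KdVSolution n j,
      (∀ (γ : CurveFlowSolution n j) (x t : ℝ),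
        (F (Quotient.mk _ γ)).1 x t = curvature n (fun y => γ.1 y t) x) ∧
      Function.Bijective F := by
  have eq_of_smul : ∀ (γ : CurveFlowSolution n j) (c : Matrix.SpecialLinearGroup (Fin n) ℝ) (t : ℝ),
      curvature n (fun y => (c • γ).1 y t) = curvature n fun y => γ.1 y t := fun γ c t =>
    curvature_mulVec c (γ.2.mem t).smooth
  refine ⟨fun γ₁ γ₂ h₁ h₂ => ⟨h₁.exists_eq_mulVec hn hj h₂, ?_⟩, ?_⟩
  · rintro ⟨c, hc⟩ t
    simp only [hc]
    exact (curvature_mulVec c (h₁.mem t).smooth).symm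
  · refine ⟨Quotient.lift
      (fun γ => ⟨fun x t => curvature n (fun y => γ.1 y t) x, γ.2.isKdVSolution hn hj⟩) ?_,
      fun γ x t => rfl, ?_, ?_⟩
    · rintro γ₁ γ₂ ⟨c, rfl⟩
      exact Subtype.ext (funext fun x => funext fun t => congrFun (eq_of_smul γ₂ c t) x)
    · rintro ⟨γ₁⟩ ⟨γ₂⟩ h
      obtain ⟨c, hc⟩ := γ₂.2.exists_eq_mulVec hn hj γ₁.2 fun t =>
        funext fun x => (congrFun (congrFun (congrArg Subtype.val h) x) t).symm
      exact Quotient.sound ⟨c, Subtype.ext (funext fun x => funext fun t => (hc x t).symm)⟩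
    · rintro ⟨u, hu⟩
      obtain ⟨γ, hγ, hc⟩ := hu.exists_isCurveFlowSolution hn hj
      exact ⟨Quotient.mk _ ⟨γ, hγ⟩,
        Subtype.ext (funext fun x => funext fun t => congrFun (hc t) x)⟩
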